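/- Setting and notation. Let $n_x,n_u,n_v,n_w\ge 1$, $n_z=n_x+n_u$ and $d(n)=n(n+1)/2$. For symmetric $X\in\mathbb{R}^{n\times n}$ let $\operatorname{svec}(X)\in\mathbb{R}^{d(n)}$ list the lower triangle of $X$ with off-diagonal entries multiplied by $\sqrt2$, let $\operatorname{unsvec}$ be its inverse, and let $Q_n$ be the matrix with $Q_nQ_n^\top=I$ and $\operatorname{svec}(X)=Q_n\operatorname{vec}(X)$. Put $V\circledast U=\tfrac12Q_m(U\otimes V+V\otimes U)Q_n^\top$ for $U,V\in\mathbb{R}^{m\times n}$; in particular $x\circledast x=Q_n(x\otimes x)$ for a vector $x\in\mathbb{R}^n$. For a third-order tensor $\mathcal T$, let $\mathcal T_{(n)}$ be its $n$-mode matricization (rows are the vectorized mode-$n$ slices), $\mathcal T\bar\times_2 x=\sum_j x_j\mathcal T_{:j:}$, and $\mathcal T\circledast\mathcal T=(\mathcal T\otimes\mathcal T)\times_1Q\times_2Q\times_3Q$ (with $Q$ of the appropriate sizes). $A^+$ is the Moore–Penrose pseudo-inverse, $\|\cdot\|_2$ the spectral (or Euclidean) norm, $\preceq$ the Loewner order.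 True dynamics: for $A_i\in\mathbb{R}^{n_x\times n_x}$, $B_i\in\mathbb{R}^{n_x\times n_u}$, $i=1,\dots,n_v$, and noise $v\in\mathbb{R}^{n_v}$, $$x^+=\sum_i v_iA_i\,x+\sum_i v_iB_i\,u ,\qquad z=(x,u).$$ Let $\mathcal V\in\mathbb{R}^{n_x\times n_z\times n_v}$ have slices $\mathcal V_{::i}=[A_i,B_i]$, and let $\mathcal M\in\mathbb{R}^{n_x\times n_z\times n_w}$ be a mode tensor satisfying model equivalence: $\operatorname{rk}(\mathcal M_{(3)})=\operatorname{rk}([\mathcal M_{(3)};\mathcal V_{(3)}])=n_w$. Set $w=(\mathcal M_{(3)}^\top)^+\mathcal V_{(3)}^\top v$, assume $\|w\|_2\le r_w$ almost surely, and let $W_\star=\mathbb E[ww^\top]$. For $W\in\mathbb{R}^{n_w\times n_w}$ let $\mathcal E(W;Z)=\mathcal M_{(1)}(W\otimes Z)\mathcal M_{(1)}^\top$ and $\mathcal E_\star(Z)=\mathcal E(W_\star;Z)$. Data: for $i=1,\dots,N$ let $(x_i^+,z_i)$ be independent samples of the dynamics, $x_i^+=\sum_k (v_i)_kA_kx_i+\sum_k(v_i)_kB_ku_i$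 with $z_i=(x_i,u_i)$, where each $v_i$ is a copy of $v$ independent of $z_i$, and the $z_i$ are i.i.d. with a law that is absolutely continuous with respect to Lebesgue measure on $\mathbb{R}^{n_z}$. Estimator: with $\mathcal W=\mathcal M\circledast\mathcal M$, let $\mathbf Z_N$ be the vertical stack of $\mathcal W\bar\times_2(z_i\circledast z_i)$ and $Y_N$ that of $x_i^+\circledast x_i^+$, and let $\operatorname{svec}(\hat W)=\mathbf Z_N^+Y_N$. Let $\mathcal G(Z)=\mathcal W_{(3)}((Z\circledast Z)\otimes I_{d(n_x)})\mathcal W_{(3)}^\top$ and $\mathbf H_i=\big[\sum_{j=1}^N\mathcal G(z_jz_j^\top)\big]^+\mathcal G(z_iz_i^\top)$. Let $\mathcal H_i(X)=\operatorname{unsvec}(\mathbf H_i\operatorname{svec}(X))$ be the associated operator on symmetric $n_w\times n_w$ matrices, with $\|\mathcal H_i\|_2=\max\{\|\mathcal H_i(X)\|_2: X=X^\top,\ \|X\|_2\le1\}$, and set $\zeta_W=\big(\sum_{i=1}^N\|\mathcal H_i\|_2^2\big)^{1/2}$. Theorem. If $N\ge d(n_z)$ and $\delta\in(0,1)$, then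 with $\beta_W=r_w^2\,\zeta_W\sqrt{2\log(2n_w/\delta)}$, $$\mathbb P\Big[\ \mathcal E(\hat W-\beta_WI;Z)\preceq\mathcal E_\star(Z)\preceq\mathcal E(\hat W+\beta_WI;Z)\quad\text{for all symmetric } Z\succeq0\ \Big]\ \ge\ 1-\delta .$$ -/

import Mathlib

open MeasureTheory ProbabilityTheory
open scoped Matrix Kronecker

namespace MultNoise

/-! ### Moore-Penrose pseudo-inverse and spectral norm -/

section PseudoInverse

variable {m n : Type*} [Fintype m] [Fintype n]

/-- The four Penrose conditions: `B` is a Moore-Penrose pseudo-inverse of the real matrix `A`. -/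
def IsMoorePenrose (A : Matrix m n ℝ) (B : Matrix n m ℝ) : Prop :=
  A * B * A = A ∧ B * A * B = B ∧ (A * B)ᵀ = A * B ∧ (B * A)ᵀ = B * A

theorem exists_symm_pinv [DecidableEq n] (S : Matrix n n ℝ) (hS : S.IsHermitian) :
    ∃ G : Matrix n n ℝ, S * G * S = S ∧ G * S * G = G ∧ Gᵀ = G ∧ G * S = S * G := by
  obtain ⟨U, hU1, d, hd⟩ : ∃ U : Matrix n n ℝ, Uᵀ * U = 1 ∧
      ∃ d : n → ℝ, S = U * Matrix.diagonal d * Uᵀ := by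
    refine ⟨hS.eigenvectorUnitary, ?_, hS.eigenvalues, ?_⟩
    · have := Unitary.coe_star_mul_self hS.eigenvectorUnitary
      simpa [Matrix.star_eq_conjTranspose] using this
    · have := hS.spectral_theorem
      rw [Unitary.conjStarAlgAut_apply] at this
      simpa [Matrix.star_eq_conjTranspose, Function.comp_def] using this
  have key : ∀ a b : n → ℝ, (U * Matrix.diagonal a * Uᵀ) * (U * Matrix.diagonal b * Uᵀ) =
      U * Matrix.diagonal (fun i => a i * b i) * Uᵀ := by
    intro a b
    calc (U * Matrix.diagonal a * Uᵀ) * (U * Matrix.diagonal b * Uᵀ)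
        = U * Matrix.diagonal a * (Uᵀ * U) * Matrix.diagonal b * Uᵀ := by
          simp only [Matrix.mul_assoc]
      _ = _ := by rw [hU1, Matrix.mul_one, Matrix.mul_assoc U, Matrix.diagonal_mul_diagonal]
  refine ⟨U * Matrix.diagonal (fun i => (d i)⁻¹) * Uᵀ, ?_, ?_, ?_, ?_⟩
  · rw [hd, key, key]
    congr 3
    funext i
    exact mul_inv_mul_cancel (d i)
  · rw [hd, key, key]
    congr 3
    funext i
    simpa using mul_inv_mul_cancel (d i)⁻¹
  · simp [Matrix.transpose_mul, Matrix.mul_assoc]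
  · rw [hd, key, key]
    congr 3
    funext i
    exact mul_comm _ _

theorem exists_isMoorePenrose (A : Matrix m n ℝ) : ∃ B, IsMoorePenrose A B := by
  classical
  have hS : (Aᵀ * A).IsHermitian := by
    simpa using Matrix.isHermitian_conjTranspose_mul_self A
  obtain ⟨G, h1, h2, h3, h4⟩ := exists_symm_pinv (Aᵀ * A) hS
  have hA : A * G * (Aᵀ * A) = A := by
    have hz : (A * G * (Aᵀ * A) - A)ᵀ * (A * G * (Aᵀ * A) - A) = 0 := by
      have : (A * G * (Aᵀ * A) - A)ᵀ * (A * G * (Aᵀ * A) - A) =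
          Aᵀ * A * G * (Aᵀ * A * G * (Aᵀ * A)) - Aᵀ * A * G * (Aᵀ * A)
            - (Aᵀ * A * G * (Aᵀ * A) - Aᵀ * A) := by
        simp only [Matrix.transpose_sub, Matrix.transpose_mul, Matrix.transpose_transpose, h3,
          Matrix.sub_mul, Matrix.mul_sub, Matrix.mul_assoc]
      rw [this, h1, h1]
      simp
    have hz' : (A * G * (Aᵀ * A) - A)ᴴ * (A * G * (Aᵀ * A) - A) = 0 := by simpa using hz
    exact sub_eq_zero.mp (Matrix.conjTranspose_mul_self_eq_zero.mp hz')
  refine ⟨G * Aᵀ, ?_, ?_, ?_, ?_⟩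
  · simpa [Matrix.mul_assoc] using hA
  · calc G * Aᵀ * A * (G * Aᵀ) = (G * (Aᵀ * A) * G) * Aᵀ := by simp only [Matrix.mul_assoc]
      _ = _ := by rw [h2]
  · simp [Matrix.transpose_mul, h3, Matrix.mul_assoc]
  · have : G * Aᵀ * A = G * (Aᵀ * A) := Matrix.mul_assoc _ _ _
    rw [this, Matrix.transpose_mul, h3, h4]
    simp [Matrix.transpose_mul]

theorem IsMoorePenrose.unique {A : Matrix m n ℝ} {B C : Matrix n m ℝ}
    (hB : IsMoorePenrose A B) (hC : IsMoorePenrose A C) : B = C := by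
  obtain ⟨b1, b2, b3, b4⟩ := hB
  obtain ⟨c1, c2, c3, c4⟩ := hC
  have e1 : A * B = A * C := by
    calc A * B = (A * C * A) * B := by rw [c1]
      _ = (A * C) * (A * B) := by simp only [Matrix.mul_assoc]
      _ = (A * C)ᵀ * (A * B)ᵀ := by rw [b3, c3]
      _ = ((A * B * A) * C)ᵀ := by rw [← Matrix.transpose_mul]; simp only [Matrix.mul_assoc]
      _ = A * C := by rw [b1, c3]
  have e2 : B * A = C * A := by
    calc B * A = B * (A * C * A) := by rw [c1]
      _ = (B * A) * (C * A) := by simp only [Matrix.mul_assoc]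
      _ = (B * A)ᵀ * (C * A)ᵀ := by rw [b4, c4]
      _ = (C * (A * B * A))ᵀ := by rw [← Matrix.transpose_mul]; simp only [Matrix.mul_assoc]
      _ = C * A := by rw [b1, c4]
  calc B = B * A * B := b2.symm
    _ = C * (A * B) := by rw [e2, Matrix.mul_assoc]
    _ = C * A * C := by rw [e1, Matrix.mul_assoc]
    _ = C := c2

/-- The Moore-Penrose pseudo-inverse of a real matrix. -/
noncomputable def pinv (A : Matrix m n ℝ) : Matrix n m ℝ :=
  (exists_isMoorePenrose A).choose

open scoped Matrix.Norms.L2Operator in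
/-- The spectral norm of a matrix (operator norm for the Euclidean norms). -/
noncomputable def specNorm [DecidableEq n] (A : Matrix m n ℝ) : ℝ := ‖A‖

end PseudoInverse

/-! ### Symmetrized vectorization and symmetrized Kronecker product -/

/-- Index set of `svec`: positions `(i, j)` with `j ≤ i` in the lower triangle.
It has `d (d + 1) / 2` elements. -/
abbrev SIdx (d : ℕ) : Type := {p : Fin d × Fin d // p.2 ≤ p.1}

/-- `svec X`: diagonal entries, and `√2` times the entries strictly below the diagonal. -/
noncomputable def svec {d : ℕ} (X : Matrix (Fin d) (Fin d) ℝ) : SIdx d → ℝ :=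
  fun p => if p.1.1 = p.1.2 then X p.1.1 p.1.2 else √2 * X p.1.1 p.1.2

/-- The inverse of `svec`, with values in the symmetric matrices. -/
noncomputable def unsvec {d : ℕ} (y : SIdx d → ℝ) : Matrix (Fin d) (Fin d) ℝ :=
  Matrix.of fun i j =>
    if i = j then y ⟨(i, i), le_rfl⟩
    else if h : j ≤ i then y ⟨(i, j), h⟩ / √2
    else y ⟨(j, i), (lt_of_not_ge h).le⟩ / √2

/-- The matrix `Q_d` with orthonormal rows such that `svec X = Q_d vec X` for symmetric `X`. -/
noncomputable def symQ (d : ℕ) : Matrix (SIdx d) (Fin d × Fin d) ℝ :=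
  Matrix.of fun p q =>
    if p.1.1 = p.1.2 then (if q = p.1 then 1 else 0)
    else (if q = p.1 ∨ q = p.1.swap then 1 / √2 else 0)

/-- The symmetrized Kronecker product `½ Q_m (U ⊗ V + V ⊗ U) Q_nᵀ` of matrices. -/
noncomputable def skron {m n : ℕ} (V U : Matrix (Fin m) (Fin n) ℝ) :
    Matrix (SIdx m) (SIdx n) ℝ :=
  (1 / 2 : ℝ) • (symQ m * (U ⊗ₖ V + V ⊗ₖ U) * (symQ n)ᵀ)

/-- The symmetrized Kronecker square `Q_n (x ⊗ x)` of a (column) vector. -/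
noncomputable def skronVec {n : ℕ} (x : Fin n → ℝ) : SIdx n → ℝ :=
  symQ n *ᵥ fun q => x q.1 * x q.2

/-! ### Third-order tensors -/

/-- Real third-order tensors. -/
abbrev Tensor (I J K : Type*) := I → J → K → ℝ

section Tensors

variable {I J K I' J' K' : Type*}

/-- The 1-mode matricization, whose `i`-th row is `vec` of the slice `T_{i::}`. -/
def unfold1 (T : Tensor I J K) : Matrix I (K × J) ℝ :=
  Matrix.of fun i => Matrix.vec (Matrix.of fun j k => T i j k)

/-- The 3-mode matricization, whose `k`-th row is `vec` of the slice `T_{::k}`. -/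
def unfold3 (T : Tensor I J K) : Matrix K (J × I) ℝ :=
  Matrix.of fun k => Matrix.vec (Matrix.of fun i j => T i j k)

/-- The mode-2 vector product of a tensor and a vector. -/
def mode2Vec [Fintype J] (T : Tensor I J K) (x : J → ℝ) : Matrix I K ℝ :=
  Matrix.of fun i k => ∑ j, x j * T i j k

/-- The Tucker operator `⟦T; X₁, X₂, X₃⟧`. -/
def tucker [Fintype I] [Fintype J] [Fintype K] (T : Tensor I J K)
    (X₁ : Matrix I' I ℝ) (X₂ : Matrix J' J ℝ) (X₃ : Matrix K' K ℝ) : Tensor I' J' K' :=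
  fun a b c => ∑ i, ∑ j, ∑ k, X₁ a i * X₂ b j * X₃ c k * T i j k

/-- The Kronecker square of a tensor: its slice at `(j, i)` is `T_{j::} ⊗ T_{i::}`. -/
def tensorKron (T : Tensor I J K) : Tensor (I × I) (J × J) (K × K) :=
  fun i j k => ((Matrix.of (T i.1)) ⊗ₖ (Matrix.of (T i.2))) j k

end Tensors

/-- The symmetrized Kronecker square of a tensor. -/
noncomputable def tensorSkron {p q r : ℕ} (T : Tensor (Fin p) (Fin q) (Fin r)) :
    Tensor (SIdx p) (SIdx q) (SIdx r) :=
  tucker (tensorKron T) (symQ p) (symQ q) (symQ r)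

/-! ### The dynamics -/

section Model

variable {nx nu nv nw : ℕ}

/-- The random matrix `∑ᵢ vᵢ Aᵢ`. -/
def modeSum {a b : ℕ} (A : Fin nv → Matrix (Fin a) (Fin b) ℝ) (v : Fin nv → ℝ) :
    Matrix (Fin a) (Fin b) ℝ := ∑ i, v i • A i

/-- The true mode tensor, with slices `V_{::i} = [Aᵢ, Bᵢ]`. -/
def trueTensor (A : Fin nv → Matrix (Fin nx) (Fin nx) ℝ)
    (B : Fin nv → Matrix (Fin nx) (Fin nu) ℝ) : Tensor (Fin nx) (Fin (nx + nu)) (Fin nv) :=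
  fun a b i => Fin.append (A i a) (B i a) b

/-- Model equivalence: the 3-mode matricization of `M` has full row rank, and stacking that of the
true mode tensor `V` below it does not increase the rank. -/
def ModelEquivalence {nz : ℕ} (M : Tensor (Fin nx) (Fin nz) (Fin nw))
    (V : Tensor (Fin nx) (Fin nz) (Fin nv)) : Prop :=
  (unfold3 M).rank = nw ∧ (Matrix.fromRows (unfold3 M) (unfold3 V)).rank = nw

/-- The noise `w = (M₍₃₎ᵀ)⁺ V₍₃₎ᵀ v` in the coordinates of the mode tensor `M`. -/
noncomputable def modelNoise {nz : ℕ} (M : Tensor (Fin nx) (Fin nz) (Fin nw))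
    (V : Tensor (Fin nx) (Fin nz) (Fin nv)) (v : Fin nv → ℝ) : Fin nw → ℝ :=
  pinv (unfold3 M)ᵀ *ᵥ ((unfold3 V)ᵀ *ᵥ v)

/-- The true second moment `W⋆ = E[w wᵀ]` of the model noise, for `v` with law `ν`. -/
noncomputable def trueMoment {nz : ℕ} (M : Tensor (Fin nx) (Fin nz) (Fin nw))
    (V : Tensor (Fin nx) (Fin nz) (Fin nv)) (ν : Measure (Fin nv → ℝ)) :
    Matrix (Fin nw) (Fin nw) ℝ :=
  Matrix.of fun i j => ∫ v, modelNoise M V v i * modelNoise M V v j ∂ν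

/-- The second moment dynamics `E(W; Z) = M₍₁₎ (W ⊗ Z) M₍₁₎ᵀ`. -/
def momentMap {nz : ℕ} (M : Tensor (Fin nx) (Fin nz) (Fin nw))
    (W : Matrix (Fin nw) (Fin nw) ℝ) (Z : Matrix (Fin nz) (Fin nz) ℝ) :
    Matrix (Fin nx) (Fin nx) ℝ :=
  unfold1 M * (W ⊗ₖ Z) * (unfold1 M)ᵀ

end Model

/-! ### The least-squares estimator and the error radius -/

section Estimator

variable {nx nz nw N : ℕ}

/-- The stacked regressor matrix, with blocks `𝒲 ×₂ (zᵢ ⊛ zᵢ)` for `𝒲 = M ⊛ M`. -/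
noncomputable def dataMatrix (M : Tensor (Fin nx) (Fin nz) (Fin nw)) (z : Fin N → Fin nz → ℝ) :
    Matrix (Fin N × SIdx nx) (SIdx nw) ℝ :=
  Matrix.of fun i => mode2Vec (tensorSkron M) (skronVec (z i.1)) i.2

/-- The stacked observations `x⁺ᵢ ⊛ x⁺ᵢ`. -/
noncomputable def dataVector (xplus : Fin N → Fin nx → ℝ) : Fin N × SIdx nx → ℝ :=
  fun i => skronVec (xplus i.1) i.2

/-- The least-squares estimate of the second moment of the noise. -/
noncomputable def lsEstimate (M : Tensor (Fin nx) (Fin nz) (Fin nw)) (z : Fin N → Fin nz → ℝ)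
    (xplus : Fin N → Fin nx → ℝ) : Matrix (Fin nw) (Fin nw) ℝ :=
  unsvec (pinv (dataMatrix M z) *ᵥ dataVector xplus)

/-- `𝒲(Z) = 𝒲₍₃₎ ((Z ⊛ Z) ⊗ I) 𝒲₍₃₎ᵀ` for `𝒲 = M ⊛ M`. -/
noncomputable def gramOp (M : Tensor (Fin nx) (Fin nz) (Fin nw)) (Z : Matrix (Fin nz) (Fin nz) ℝ) :
    Matrix (SIdx nw) (SIdx nw) ℝ :=
  unfold3 (tensorSkron M) * (skron Z Z ⊗ₖ (1 : Matrix (SIdx nx) (SIdx nx) ℝ)) *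
    (unfold3 (tensorSkron M))ᵀ

/-- The matrix `Hᵢ = [∑ⱼ 𝒲(zⱼ zⱼᵀ)]⁺ 𝒲(zᵢ zᵢᵀ)`. -/
noncomputable def hMatrix (M : Tensor (Fin nx) (Fin nz) (Fin nw)) (z : Fin N → Fin nz → ℝ)
    (i : Fin N) : Matrix (SIdx nw) (SIdx nw) ℝ :=
  pinv (∑ j, gramOp M (Matrix.vecMulVec (z j) (z j))) *
    gramOp M (Matrix.vecMulVec (z i) (z i))

/-- The linear operator on symmetric matrices with matrix `S`, `X ↦ unsvec (S svec X)`. -/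
noncomputable def symOp {m n : ℕ} (S : Matrix (SIdx m) (SIdx n) ℝ)
    (X : Matrix (Fin n) (Fin n) ℝ) : Matrix (Fin m) (Fin m) ℝ :=
  unsvec (S *ᵥ svec X)

/-- The norm of the operator with matrix `S`, induced by the spectral norms: the maximum of
`‖S(X)‖₂` over symmetric `X` with `‖X‖₂ ≤ 1`. -/
noncomputable def symOpNorm {m n : ℕ} (S : Matrix (SIdx m) (SIdx n) ℝ) : ℝ :=
  sSup {t | ∃ X : Matrix (Fin n) (Fin n) ℝ, X.IsSymm ∧ specNorm X ≤ 1 ∧ t = specNorm (symOp S X)}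

/-- `ζ_W`, with `ζ_W² = ∑ᵢ ‖Hᵢ‖₂²`. -/
noncomputable def zetaW (M : Tensor (Fin nx) (Fin nz) (Fin nw)) (z : Fin N → Fin nz → ℝ) : ℝ :=
  √(∑ i, symOpNorm (hMatrix M z i) ^ 2)

/-- The radius `β_W = r_w² ζ_W √(2 log (2 n_w / δ))`. -/
noncomputable def betaW (M : Tensor (Fin nx) (Fin nz) (Fin nw)) (rw δ : ℝ)
    (z : Fin N → Fin nz → ℝ) : ℝ :=
  rw ^ 2 * zetaW M z * √(2 * Real.log (2 * nw / δ))

end Estimator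

end MultNoise

open MultNoise

namespace MultNoise

/-! ### The Golden-Thompson inequality -/

/-! ### Lie product formula along dyadic steps. -/

section LieTrotter

open Filter Topology NormedSpace

/-! Model equivalence rewrites the dynamics as `x⁺ = (M ×₂ z) w`. Symmetrized Kronecker squares make
`x⁺ ⊛ x⁺` linear in `svec (w wᵀ)`, and the normal equations then give the exact identity `Ŵ = ∑ᵢ
Hᵢ(wᵢ wᵢᵀ)` (`lsEstimate_eq_sum_symOp`). Hence `Ŵ - ∑ᵢ Hᵢ(W⋆) = ∑ᵢ Hᵢ(wᵢ wᵢᵀ - W⋆)`, which for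
frozen `zᵢ` is a sum of independent centred symmetric matrices of spectral norm at most `r² ‖Hᵢ‖`.

A matrix Hoeffding inequality (`measure_not_abs_sum_le_le`) places this sum between `-β I` and `β I`
with probability at least `1 - δ`. Its summands are bounded by multiples `c I` of the identity, so
Golden-Thompson suffices: it splits off one summand `X`, and the chord bound `exp X ≼ cosh c I +
(sinh c / c) X` is affine in `X`, so its mean is the scalar `cosh c`. Scalars commute with
everything, and the summands can be removed one at a time.

The operators `Hᵢ` sum to the orthogonal projection onto the row space of the regressor, which may
be rank deficient, so `∑ᵢ Hᵢ(W⋆)` can differ from `W⋆`. The difference `R` satisfies `(M ×₂ zᵢ) R (M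
×₂ zᵢ)ᵀ = 0` for every `i` (`mode2Vec_mul_residual_eq_zero`). Since `N ≥ d(n_z)` and the `zᵢ` have
an absolutely continuous law, the vectors `zᵢ ⊛ zᵢ` almost surely span, so `E(R; Z) = 0` for all
symmetric `Z` (`momentMap_eq_of_residual_eq_zero`). The projection may thus replace `W⋆`, and
monotonicity of `E(·; Z)` for `Z ≽ 0` gives both bounds for all `Z` at once. -/

theorem norm_pow_sub_pow_le {𝔸 : Type*} [NormedRing 𝔸] [NormOneClass 𝔸] {X Y : 𝔸} {L : ℝ} (hL : 1 ≤ L) (hX : ‖X‖ ≤ L) (hY : ‖Y‖ ≤ L) (n : ℕ) :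
    ‖X ^ n - Y ^ n‖ ≤ n * L ^ n * ‖X - Y‖ := by
  have hL0 : 0 ≤ L := zero_le_one.trans hL
  induction n with
  | zero => simp
  | succ n ih =>
    have h1 : X ^ (n + 1) - Y ^ (n + 1) = X ^ n * (X - Y) + (X ^ n - Y ^ n) * Y := by
      rw [pow_succ, pow_succ]; noncomm_ring
    have h2 : ‖X ^ n * (X - Y)‖ ≤ L ^ (n + 1) * ‖X - Y‖ := by
      refine (norm_mul_le _ _).trans ?_
      gcongr
      calc ‖X ^ n‖ ≤ ‖X‖ ^ n := norm_pow_le _ _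
        _ ≤ L ^ n := by gcongr
        _ ≤ L ^ (n + 1) := pow_le_pow_right₀ hL (Nat.le_succ n)
    have h3 : ‖(X ^ n - Y ^ n) * Y‖ ≤ n * L ^ n * ‖X - Y‖ * L := by
      refine (norm_mul_le _ _).trans ?_
      gcongr
    rw [h1]
    refine (norm_add_le _ _).trans ((add_le_add h2 h3).trans (le_of_eq ?_))
    push_cast
    ring

variable {𝔸 : Type*} [NormedRing 𝔸] [NormedAlgebra ℝ 𝔸] [CompleteSpace 𝔸] [NormOneClass 𝔸]

theorem norm_exp_le_exp_norm {𝔸 : Type*} [NormedRing 𝔸] [NormedAlgebra ℝ 𝔸] [NormOneClass 𝔸]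
    [CompleteSpace 𝔸] (x : 𝔸) : ‖exp x‖ ≤ Real.exp ‖x‖ := by
  rw [Real.exp_eq_exp_ℝ, exp_eq_tsum ℝ, exp_eq_tsum ℝ]
  refine tsum_of_norm_bounded (expSeries_summable' (𝕂 := ℝ) ‖x‖).hasSum fun k => ?_
  rw [norm_smul, smul_eq_mul, Real.norm_of_nonneg (by positivity)]
  gcongr
  exact norm_pow_le x k

/-- At step `s = 2⁻ᵏ` the two factors differ by `o(s)`, and raising to the power `2ᵏ = 1/s`
multiplies the error by at most a constant times `1/s`. Dyadic steps are enough, and they match the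
powers reached by `trace_pow_le_aux`. -/
theorem tendsto_exp_mul_exp_pow (A B : 𝔸) :
    Tendsto (fun k : ℕ => (exp ((1 / 2 ^ k : ℝ) • A) * exp ((1 / 2 ^ k : ℝ) • B)) ^ (2 ^ k)) atTop
      (𝓝 (exp (A + B))) := by
  -- Both terms have derivative `A + B` at `0`, so `f` vanishes there to first order.
  let f : ℝ → 𝔸 := fun t => exp (t • A) * exp (t • B) - exp (t • (A + B))
  have hf : HasDerivAt f 0 0 := by
    have h := ((hasDerivAt_exp_smul_const A (0 : ℝ)).mul
      (hasDerivAt_exp_smul_const B (0 : ℝ))).sub (hasDerivAt_exp_smul_const (A + B) (0 : ℝ))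
    simp only [zero_smul, exp_zero, one_mul, mul_one, sub_self] at h
    exact h
  have ht : Tendsto (fun k : ℕ => (1 / 2 ^ k : ℝ)) atTop (𝓝[≠] 0) := by
    refine tendsto_nhdsWithin_iff.2 ⟨?_, Eventually.of_forall fun k => by simp⟩
    simpa [one_div] using tendsto_pow_atTop_nhds_zero_of_lt_one (r := (1 / 2 : ℝ))
      (by norm_num) (by norm_num)
  have h1 := (hasDerivAt_iff_tendsto_slope_zero.1 hf).comp ht
  have h2 := (h1.norm.const_mul (Real.exp (‖A‖ + ‖B‖)))
  rw [norm_zero, mul_zero] at h2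
  rw [tendsto_iff_norm_sub_tendsto_zero]
  refine squeeze_zero (fun _ => norm_nonneg _) (fun k => ?_) h2
  set s : ℝ := 1 / 2 ^ k with hs
  have hs0 : 0 < s := by positivity
  have hsn : s * (2 ^ k : ℕ) = 1 := by simp [hs]
  have hY : exp (A + B) = exp (s • (A + B)) ^ (2 ^ k) := by
    have : NormedAlgebra ℚ 𝔸 := NormedAlgebra.restrictScalars ℚ ℝ 𝔸
    rw [← exp_nsmul, ← Nat.cast_smul_eq_nsmul ℝ, smul_smul, mul_comm, hsn, one_smul]
  have hexp : ∀ C : 𝔸, ‖exp (s • C)‖ ≤ Real.exp (s * ‖C‖) := fun C => by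
    refine (norm_exp_le_exp_norm _).trans_eq ?_
    rw [norm_smul, Real.norm_of_nonneg hs0.le]
  have hXL : ‖exp (s • A) * exp (s • B)‖ ≤ Real.exp (s * (‖A‖ + ‖B‖)) := by
    rw [mul_add, Real.exp_add]
    exact (norm_mul_le _ _).trans (mul_le_mul (hexp A) (hexp B) (norm_nonneg _) (by positivity))
  have hYL : ‖exp (s • (A + B))‖ ≤ Real.exp (s * (‖A‖ + ‖B‖)) :=
    (hexp _).trans (by gcongr; exact norm_add_le _ _)
  rw [hY]
  refine (norm_pow_sub_pow_le (Real.one_le_exp (by positivity)) hXL hYL _).trans_eq ?_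
  rw [← Real.exp_nat_mul, ← mul_assoc, mul_comm _ s, hsn, one_mul]
  have hk : ((2 ^ k : ℕ) : ℝ) = s⁻¹ := by simp [hs]
  simp only [Function.comp, ← hs, f, zero_add, zero_smul, exp_zero, mul_one, sub_self, sub_zero,
    norm_smul, norm_inv, Real.norm_of_nonneg hs0.le, hk]
  ring

end LieTrotter

/-! ### Trace inequalities for dyadic powers, and their limit. -/

section GoldenThompson

open Filter Topology NormedSpace

variable {n : Type*} [Fintype n]

theorem trace_mul_transpose_self_nonneg (X : Matrix n n ℝ) : 0 ≤ (X * Xᵀ).trace := by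
  have := (Matrix.posSemidef_self_mul_conjTranspose X).trace_nonneg
  simpa using this

/-- Expand the squared Frobenius norm of `X - Xᵀ`. -/
theorem trace_mul_self_le (X : Matrix n n ℝ) : (X * X).trace ≤ (X * Xᵀ).trace := by
  have h := trace_mul_transpose_self_nonneg (X - Xᵀ)
  have e1 : (Xᵀ * Xᵀ).trace = (X * X).trace := by
    rw [← Matrix.transpose_mul, Matrix.trace_transpose]
  have e2 : (Xᵀ * X).trace = (X * Xᵀ).trace := Matrix.trace_mul_comm _ _
  simp only [Matrix.transpose_sub, Matrix.transpose_transpose, Matrix.sub_mul, Matrix.mul_sub,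
    Matrix.trace_sub, e1, e2] at h
  linarith

theorem two_mul_trace_mul_le {P R : Matrix n n ℝ} (hP : P.IsSymm) (hR : R.IsSymm) :
    2 * (P * R).trace ≤ (P * P).trace + (R * R).trace := by
  have h := trace_mul_transpose_self_nonneg (P - R)
  have e2 : (R * P).trace = (P * R).trace := Matrix.trace_mul_comm _ _
  simp only [Matrix.transpose_sub, hP.eq, hR.eq, Matrix.sub_mul, Matrix.mul_sub,
    Matrix.trace_sub, e2] at h
  linarith

variable [DecidableEq n]

theorem trace_mul_pow_comm (X Y : Matrix n n ℝ) (m : ℕ) :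
    ((X * Y) ^ m).trace = ((Y * X) ^ m).trace := by
  cases m with
  | zero => simp
  | succ m =>
    have h : ∀ m : ℕ, (X * Y) ^ m * X = X * (Y * X) ^ m := fun m => by
      induction m with
      | zero => simp
      | succ m ih => rw [pow_succ, pow_succ', Matrix.mul_assoc, Matrix.mul_assoc X Y X,
          ← Matrix.mul_assoc _ X, ih]; simp only [Matrix.mul_assoc, ← pow_succ, ← pow_succ']
    rw [pow_succ, ← Matrix.mul_assoc, h, Matrix.mul_assoc, Matrix.trace_mul_comm, Matrix.mul_assoc,
      ← pow_succ]

/-- The two claims feed each other. The first for `X` at the next level is the first for `X * X`,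
then cyclicity, then the second for the pair `X * Xᵀ`, `Xᵀ * X`, and finally the
arithmetic-geometric bound on the trace. The second at the next level is the first for `A * B`, then
the second for the pair `A ^ 2`, `B ^ 2`. -/
theorem trace_pow_le_aux (j : ℕ) :
    (∀ X : Matrix n n ℝ, (X ^ 2 ^ (j + 1)).trace ≤ ((X * Xᵀ) ^ 2 ^ j).trace) ∧
    (∀ A B : Matrix n n ℝ, A.IsSymm → B.IsSymm →
      ((A * B) ^ 2 ^ j).trace ≤ (A ^ 2 ^ j * B ^ 2 ^ j).trace) := by
  induction j with
  | zero => exact ⟨fun X => by simpa [pow_two] using trace_mul_self_le X, fun A B _ _ => by simp⟩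
  | succ j ih =>
    obtain ⟨hI, hJ⟩ := ih
    refine ⟨fun X => ?_, fun A B hA hB => ?_⟩
    · have hP : (Xᵀ * X).IsSymm := Matrix.isSymm_transpose_mul_self X
      have hR : (X * Xᵀ).IsSymm := Matrix.isSymm_mul_transpose_self X
      have h1 : (X ^ 2 ^ (j + 1 + 1)).trace ≤ ((X * X * (X * X)ᵀ) ^ 2 ^ j).trace := by
        have := hI (X * X)
        rwa [← pow_two X, ← pow_mul, ← pow_succ', pow_two] at this
      have h2 : ((X * X * (X * X)ᵀ) ^ 2 ^ j).trace = ((X * Xᵀ * (Xᵀ * X)) ^ 2 ^ j).trace := by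
        rw [Matrix.transpose_mul, Matrix.mul_assoc X X, trace_mul_pow_comm]
        simp only [Matrix.mul_assoc]
      have h3 := hJ _ _ hR hP
      have h4 := two_mul_trace_mul_le (hR.pow (2 ^ j)) (hP.pow (2 ^ j))
      simp only [← pow_two, ← pow_mul, ← pow_succ] at h4
      have h5 := trace_mul_pow_comm Xᵀ X (2 ^ (j + 1))
      linarith
    · have h1 := hI (A * B)
      have h2 : ((A * B * (A * B)ᵀ) ^ 2 ^ j).trace = ((A ^ 2 * B ^ 2) ^ 2 ^ j).trace := by
        rw [Matrix.transpose_mul, hA.eq, hB.eq, Matrix.mul_assoc A B, trace_mul_pow_comm,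
          trace_mul_pow_comm (A ^ 2)]
        simp only [Matrix.mul_assoc, pow_two]
      have h3 := hJ _ _ (hA.pow 2) (hB.pow 2)
      rw [← pow_mul, ← pow_mul, ← pow_succ'] at h3
      linarith

/-- The Golden-Thompson inequality. -/
theorem trace_exp_add_le {A B : Matrix n n ℝ} (hA : A.IsSymm) (hB : B.IsSymm) :
    (exp (A + B)).trace ≤ (exp A * exp B).trace := by
  open scoped Matrix.Norms.L2Operator in
  -- Over an empty index type the matrix ring is trivial and `‖1‖ = 1` fails, which the limit
  -- formula needs.
  cases isEmpty_or_nonempty n with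
  | inl h => simp [Matrix.trace]
  | inr h =>
    have ht := ((Continuous.matrix_trace continuous_id).tendsto (exp (A + B))).comp
      (tendsto_exp_mul_exp_pow A B)
    refine le_of_tendsto ht (Eventually.of_forall fun k => ?_)
    -- With both arguments scaled by `2⁻ᵏ`, the right-hand side is the same for every `k`.
    have h1 := (trace_pow_le_aux k).2 _ _ (hA.smul (1 / 2 ^ k : ℝ)).exp (hB.smul (1 / 2 ^ k : ℝ)).exp
    have h2 : ∀ C : Matrix n n ℝ, exp ((1 / 2 ^ k : ℝ) • C) ^ 2 ^ k = exp C := fun C => by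
      rw [← Matrix.exp_nsmul, ← Nat.cast_smul_eq_nsmul ℝ, smul_smul]
      simp
    rw [h2, h2] at h1
    exact h1

end GoldenThompson

/-! ### A Hoeffding inequality for sums of independent symmetric random matrices -/

section SpectralBounds

open NormedSpace

variable {n : Type*} [Fintype n] [DecidableEq n]

theorem exists_orthogonal_diagonalization {X : Matrix n n ℝ} (hX : X.IsSymm) :
    ∃ (U : Matrix n n ℝ) (d : n → ℝ), Uᵀ * U = 1 ∧ U * Uᵀ = 1 ∧ X = U * Matrix.diagonal d * Uᵀ := by
  have hS : X.IsHermitian := by simpa [Matrix.IsHermitian] using hX.eq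
  have h1 : (hS.eigenvectorUnitary : Matrix n n ℝ)ᵀ * hS.eigenvectorUnitary = 1 := by
    simpa [Matrix.star_eq_conjTranspose] using Unitary.coe_star_mul_self hS.eigenvectorUnitary
  refine ⟨hS.eigenvectorUnitary, hS.eigenvalues, h1, mul_eq_one_comm.1 h1, ?_⟩
  have := hS.spectral_theorem
  rw [Unitary.conjStarAlgAut_apply] at this
  simpa [Matrix.star_eq_conjTranspose, Function.comp_def] using this

theorem exp_conj_diagonal {U : Matrix n n ℝ} (hU : Uᵀ * U = 1) (d : n → ℝ) :
    exp (U * Matrix.diagonal d * Uᵀ) = U * Matrix.diagonal (fun i => Real.exp (d i)) * Uᵀ := by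
  have hU' : U * Uᵀ = 1 := mul_eq_one_comm.1 hU
  have hinv : U⁻¹ = Uᵀ := Matrix.inv_eq_right_inv hU'
  have hunit : IsUnit U := ⟨⟨U, Uᵀ, hU', hU⟩, rfl⟩
  rw [← hinv, Matrix.exp_conj _ _ hunit, Matrix.exp_diagonal]
  congr 3
  funext i
  rw [Pi.coe_exp, Real.exp_eq_exp_ℝ]

theorem posSemidef_conj_diagonal_iff {U : Matrix n n ℝ} (hU : Uᵀ * U = 1) (d : n → ℝ) :
    (U * Matrix.diagonal d * Uᵀ).PosSemidef ↔ ∀ i, 0 ≤ d i := by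
  refine ⟨fun h => ?_, fun h => ?_⟩
  · have := h.conjTranspose_mul_mul_same U
    rw [Matrix.conjTranspose_eq_transpose_of_trivial] at this
    have e : Uᵀ * (U * Matrix.diagonal d * Uᵀ) * U = Matrix.diagonal d := by
      calc Uᵀ * (U * Matrix.diagonal d * Uᵀ) * U
          = (Uᵀ * U) * Matrix.diagonal d * (Uᵀ * U) := by simp only [Matrix.mul_assoc]
        _ = Matrix.diagonal d := by simp [hU]
    rw [e] at this
    exact Matrix.posSemidef_diagonal_iff.1 this
  · simpa using (Matrix.posSemidef_diagonal_iff.2 h).mul_mul_conjTranspose_same U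

theorem smul_one_add_smul_conj_diagonal {U : Matrix n n ℝ} (hU : U * Uᵀ = 1) (d : n → ℝ)
    (a b : ℝ) : a • (1 : Matrix n n ℝ) + b • (U * Matrix.diagonal d * Uᵀ) =
      U * Matrix.diagonal (fun i => a + b * d i) * Uᵀ := by
  have : Matrix.diagonal (fun i => a + b * d i) = a • (1 : Matrix n n ℝ) + b • Matrix.diagonal d := by
    ext i j
    by_cases h : i = j <;> simp [h]
  rw [this]
  simp [Matrix.mul_add, Matrix.add_mul, hU]

theorem abs_le_of_posSemidef {U : Matrix n n ℝ} (hU : Uᵀ * U = 1) {d : n → ℝ} {c : ℝ}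
    (h1 : (c • 1 - U * Matrix.diagonal d * Uᵀ).PosSemidef)
    (h2 : (c • 1 + U * Matrix.diagonal d * Uᵀ).PosSemidef) (i : n) : |d i| ≤ c := by
  have hU' : U * Uᵀ = 1 := mul_eq_one_comm.1 hU
  have e1 := smul_one_add_smul_conj_diagonal hU' d c (-1)
  have e2 := smul_one_add_smul_conj_diagonal hU' d c 1
  rw [neg_one_smul, ← sub_eq_add_neg] at e1
  rw [one_smul] at e2
  rw [e1, posSemidef_conj_diagonal_iff hU] at h1
  rw [e2, posSemidef_conj_diagonal_iff hU] at h2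
  have := h1 i
  have := h2 i
  exact abs_le.2 ⟨by linarith, by linarith⟩

/-- The right-hand side is the chord of the convex function `exp` over `[-c, c]`. For `c = 0` the
quotient is `0` by convention and `x = 0`. -/
theorem exp_le_cosh_add_sinh_mul {c x : ℝ} (hx : |x| ≤ c) :
    Real.exp x ≤ Real.cosh c + Real.sinh c / c * x := by
  obtain ⟨h1, h2⟩ := abs_le.1 hx
  rcases (abs_nonneg x |>.trans hx).eq_or_lt with hc | hc
  · have : x = 0 := by linarith
    simp [this, ← hc]
  · have h := (convexOn_exp : ConvexOn ℝ Set.univ Real.exp).2 (Set.mem_univ (-c)) (Set.mem_univ c)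
      (div_nonneg (sub_nonneg.2 h2) (by linarith) : 0 ≤ (c - x) / (2 * c))
      (div_nonneg (by linarith) (by linarith) : 0 ≤ (c + x) / (2 * c)) (by field_simp; ring)
    simp only [smul_eq_mul] at h
    have e1 : (c - x) / (2 * c) * -c + (c + x) / (2 * c) * c = x := by field_simp; ring
    rw [e1] at h
    refine h.trans_eq ?_
    rw [Real.cosh_eq, Real.sinh_eq]
    field_simp
    ring

theorem posSemidef_cosh_add_sinh_sub_exp {X : Matrix n n ℝ} (hX : X.IsSymm) {c : ℝ}
    (h1 : (c • 1 - X).PosSemidef) (h2 : (c • 1 + X).PosSemidef) :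
    (Real.cosh c • 1 + (Real.sinh c / c) • X - exp X).PosSemidef := by
  obtain ⟨U, d, hU, hU', rfl⟩ := exists_orthogonal_diagonalization hX
  rw [smul_one_add_smul_conj_diagonal hU', exp_conj_diagonal hU, ← Matrix.sub_mul,
    ← Matrix.mul_sub, Matrix.diagonal_sub, posSemidef_conj_diagonal_iff hU]
  exact fun i => sub_nonneg.2 (exp_le_cosh_add_sinh_mul (abs_le_of_posSemidef hU h1 h2 i))

theorem posSemidef_exp {X : Matrix n n ℝ} (hX : X.IsSymm) : (exp X).PosSemidef := by
  obtain ⟨U, d, hU, hU', rfl⟩ := exists_orthogonal_diagonalization hX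
  rw [exp_conj_diagonal hU, posSemidef_conj_diagonal_iff hU]
  exact fun i => (Real.exp_pos _).le

theorem trace_mul_nonneg {P Q : Matrix n n ℝ} (hP : P.PosSemidef) (hQ : Q.PosSemidef) :
    0 ≤ (P * Q).trace := by
  obtain ⟨U, d, hU, hU', rfl⟩ := exists_orthogonal_diagonalization
    (X := P) (by simpa [Matrix.IsHermitian, Matrix.IsSymm] using hP.1)
  rw [posSemidef_conj_diagonal_iff hU] at hP
  rw [Matrix.mul_assoc, Matrix.mul_assoc, Matrix.trace_mul_comm, Matrix.mul_assoc, Matrix.trace]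
  refine Finset.sum_nonneg fun i _ => ?_
  rw [Matrix.diag_apply, Matrix.diagonal_mul]
  exact mul_nonneg (hP i) (by simpa using (hQ.conjTranspose_mul_mul_same U).diag_nonneg (i := i))

/-- Golden-Thompson separates `S` from `X`; pairing the chord bound with the positive matrix `exp S`
then yields a majorant affine in `X`, whose expectation needs only the mean of `X`. -/
theorem trace_exp_add_le_cosh {S X : Matrix n n ℝ} (hS : S.IsSymm) (hX : X.IsSymm) {c : ℝ}
    (h1 : (c • 1 - X).PosSemidef) (h2 : (c • 1 + X).PosSemidef) :
    (exp (S + X)).trace ≤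
      Real.cosh c * (exp S).trace + Real.sinh c / c * (exp S * X).trace := by
  have h := trace_mul_nonneg (posSemidef_exp hS) (posSemidef_cosh_add_sinh_sub_exp hX h1 h2)
  have h' := trace_exp_add_le hS hX
  simp only [Matrix.mul_sub, Matrix.mul_add, Matrix.mul_smul, Matrix.mul_one, Matrix.trace_sub,
    Matrix.trace_add, Matrix.trace_smul, smul_eq_mul] at h
  linarith

/-- Some eigenvalue of `X` exceeds `t`, and its exponential alone bounds the trace from below. This
is the matrix form of the Chernoff step. -/
theorem exp_le_trace_exp_of_not_posSemidef {X : Matrix n n ℝ} (hX : X.IsSymm) {t θ : ℝ}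
    (hθ : 0 ≤ θ) (h : ¬ (t • 1 - X).PosSemidef) : Real.exp (θ * t) ≤ (exp (θ • X)).trace := by
  obtain ⟨U, d, hU, hU', rfl⟩ := exists_orthogonal_diagonalization hX
  have e1 := smul_one_add_smul_conj_diagonal hU' d t (-1)
  rw [neg_one_smul, ← sub_eq_add_neg] at e1
  rw [e1, posSemidef_conj_diagonal_iff hU] at h
  push Not at h
  obtain ⟨i, hi⟩ := h
  have e2 := smul_one_add_smul_conj_diagonal hU' d 0 θ
  simp only [zero_smul, zero_add] at e2
  rw [e2, exp_conj_diagonal hU, Matrix.trace_mul_comm, ← Matrix.mul_assoc, hU, Matrix.one_mul,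
    Matrix.trace_diagonal]
  calc Real.exp (θ * t) ≤ Real.exp (θ * d i) := by gcongr; linarith
    _ ≤ _ := Finset.single_le_sum (f := fun i => Real.exp (θ * d i))
      (fun j _ => (Real.exp_pos _).le) (Finset.mem_univ i)

end SpectralBounds

/-! ### Borel structure on real matrices. -/

section MatrixMeasurable

variable {m n : Type*}

instance instMeasurableSpaceMatrix : MeasurableSpace (Matrix m n ℝ) :=
  inferInstanceAs (MeasurableSpace (m → n → ℝ))

instance instBorelSpaceMatrix [Countable m] [Countable n] : BorelSpace (Matrix m n ℝ) :=
  inferInstanceAs (BorelSpace (m → n → ℝ))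

instance instPolishSpaceMatrix [Countable m] [Countable n] : PolishSpace (Matrix m n ℝ) :=
  inferInstanceAs (PolishSpace (m → n → ℝ))

theorem measurable_matrix_iff {α : Type*} [MeasurableSpace α] {f : α → Matrix m n ℝ} :
    Measurable f ↔ ∀ i j, Measurable fun a => f a i j :=
  ⟨fun h i j => (measurable_pi_apply j).comp ((measurable_pi_apply i).comp h),
    fun h => measurable_pi_lambda _ fun i => measurable_pi_lambda _ fun j => h i j⟩

theorem measurable_trace_exp [Fintype n] [DecidableEq n] :
    Measurable fun X : Matrix n n ℝ => (NormedSpace.exp X).trace := by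
  open scoped Matrix.Norms.L2Operator in
  have : NormedAlgebra ℚ (Matrix n n ℝ) := NormedAlgebra.restrictScalars ℚ ℝ _
  exact (Continuous.matrix_trace NormedSpace.exp_continuous).measurable

theorem isClosed_posSemidef [Fintype n] : IsClosed {X : Matrix n n ℝ | X.PosSemidef} := by
  simp only [Matrix.posSemidef_iff_dotProduct_mulVec, Set.ofPred_and, Set.ofPred_forall,
    Matrix.IsHermitian]
  refine IsClosed.inter (isClosed_eq (by fun_prop) (by fun_prop)) (isClosed_iInter fun x => ?_)
  exact isClosed_le continuous_const (by fun_prop)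

end MatrixMeasurable

/-! ### Exponential moments and tail bounds. -/

section Hoeffding

open NormedSpace

variable {n : Type*} [Fintype n] {V : Type*} [MeasurableSpace V]

theorem integral_trace_mul_eq_zero {ν : Measure V} {f : V → Matrix n n ℝ}
    (hint : ∀ i j, Integrable (fun v => f v i j) ν) (hmean : ∀ i j, ∫ v, f v i j ∂ν = 0)
    (K : Matrix n n ℝ) :
    Integrable (fun v => (K * f v).trace) ν ∧ ∫ v, (K * f v).trace ∂ν = 0 := by
  have htr : ∀ v, (K * f v).trace = ∑ i, ∑ j, K i j * f v j i := fun v => by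
    simp [Matrix.trace, Matrix.mul_apply]
  have h1 : ∀ i j, Integrable (fun v => K i j * f v j i) ν := fun i j => (hint j i).const_mul _
  have h2 : ∀ i, Integrable (fun v => ∑ j, K i j * f v j i) ν := fun i =>
    integrable_finsetSum _ fun j _ => h1 i j
  simp only [htr]
  refine ⟨integrable_finsetSum _ fun i _ => h2 i, ?_⟩
  rw [integral_finsetSum _ fun i _ => h2 i]
  refine Finset.sum_eq_zero fun i _ => ?_
  rw [integral_finsetSum _ fun j _ => h1 i j]
  exact Finset.sum_eq_zero fun j _ => by rw [integral_const_mul, hmean, mul_zero]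

variable [DecidableEq n]

/-- Integrating the affine majorant kills its linear term. Using the lower integral on the left
avoids any integrability question for the trace exponential. -/
theorem lintegral_trace_exp_add_le (ν : Measure V) [IsProbabilityMeasure ν]
    {f : V → Matrix n n ℝ} (hsymm : ∀ v, (f v).IsSymm)
    (hint : ∀ i j, Integrable (fun v => f v i j) ν) (hmean : ∀ i j, ∫ v, f v i j ∂ν = 0)
    {c : ℝ} (hc : ∀ᵐ v ∂ν, (c • 1 - f v).PosSemidef ∧ (c • 1 + f v).PosSemidef)
    {S : Matrix n n ℝ} (hS : S.IsSymm) :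
    ∫⁻ v, ENNReal.ofReal (exp (S + f v)).trace ∂ν ≤
      ENNReal.ofReal (Real.cosh c * (exp S).trace) := by
  set g : V → ℝ := fun v => Real.cosh c * (exp S).trace + Real.sinh c / c * (exp S * f v).trace
  obtain ⟨hint', hzero⟩ := integral_trace_mul_eq_zero hint hmean (exp S)
  have hle : ∀ᵐ v ∂ν, (exp (S + f v)).trace ≤ g v := by
    filter_upwards [hc] with v hv
    exact trace_exp_add_le_cosh hS (hsymm v) hv.1 hv.2
  have hg0 : 0 ≤ᵐ[ν] g := by
    filter_upwards [hle] with v hv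
    exact ((posSemidef_exp (hS.add (hsymm v))).trace_nonneg).trans hv
  have hgint : Integrable g ν := (integrable_const _).add (hint'.const_mul _)
  calc ∫⁻ v, ENNReal.ofReal (exp (S + f v)).trace ∂ν ≤ ∫⁻ v, ENNReal.ofReal (g v) ∂ν :=
        lintegral_mono_ae (hle.mono fun v hv => ENNReal.ofReal_le_ofReal hv)
    _ = ENNReal.ofReal (∫ v, g v ∂ν) := (ofReal_integral_eq_lintegral_ofReal hgint hg0).symm
    _ = ENNReal.ofReal (Real.cosh c * (exp S).trace) := by
        have : ∫ v, g v ∂ν = ∫ _, Real.cosh c * (exp S).trace ∂ν +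
            ∫ v, Real.sinh c / c * (exp S * f v).trace ∂ν :=
          integral_add (integrable_const _) (hint'.const_mul _)
        rw [this, integral_const_mul (Real.sinh c / c), hzero, integral_const]
        simp

/-- The arbitrary `S` serves as accumulator: with sample `0` frozen, the induction hypothesis
applies to the remaining ones with `S + f 0 v` in place of `S`, and sample `0` is integrated last.
-/
theorem lintegral_pi_trace_exp_add_le (ν : Measure V) [IsProbabilityMeasure ν] {N : ℕ}
    {f : Fin N → V → Matrix n n ℝ} (hsymm : ∀ k v, (f k v).IsSymm) (hf : ∀ k, Measurable (f k))
    (hint : ∀ k i j, Integrable (fun v => f k v i j) ν)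
    (hmean : ∀ k i j, ∫ v, f k v i j ∂ν = 0) {c : Fin N → ℝ}
    (hc : ∀ k, ∀ᵐ v ∂ν, (c k • 1 - f k v).PosSemidef ∧ (c k • 1 + f k v).PosSemidef)
    {S : Matrix n n ℝ} (hS : S.IsSymm) :
    ∫⁻ v, ENNReal.ofReal (exp (S + ∑ k, f k (v k))).trace ∂(Measure.pi fun _ : Fin N => ν) ≤
      ENNReal.ofReal ((∏ k, Real.cosh (c k)) * (exp S).trace) := by
  induction N generalizing S with
  | zero => simp
  | succ N ih =>
    have hmp := (measurePreserving_piFinSuccAbove (fun _ : Fin (N + 1) => ν) 0).symm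
    have hmeas : Measurable fun v : Fin (N + 1) → V =>
        ENNReal.ofReal (exp (S + ∑ k, f k (v k))).trace := by
      refine (measurable_trace_exp.comp ?_).ennreal_ofReal
      rw [measurable_matrix_iff]
      intro i j
      simp only [Matrix.add_apply, Matrix.sum_apply]
      exact measurable_const.add (Finset.measurable_sum _ fun k _ =>
        (measurable_matrix_iff.1 (hf k) i j).comp (measurable_pi_apply k))
    have hprod := lintegral_prod (μ := ν) (ν := Measure.pi fun _ : Fin N => ν) _
      (hmeas.comp hmp.measurable).aemeasurable
    refine ((hmp.lintegral_comp hmeas).symm.trans hprod).trans_le ?_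
    have hP : 0 ≤ ∏ k : Fin N, Real.cosh (c k.succ) :=
      Finset.prod_nonneg fun k _ => (Real.cosh_pos _).le
    calc _ ≤ ∫⁻ v, ENNReal.ofReal ((∏ k : Fin N, Real.cosh (c k.succ)) *
          (exp (S + f 0 v)).trace) ∂ν := by
          refine lintegral_mono fun v => ?_
          refine le_trans (le_of_eq ?_) (ih (fun k => hsymm k.succ) (fun k => hf k.succ)
            (fun k => hint k.succ) (fun k => hmean k.succ) (fun k => hc k.succ)
            (hS.add (hsymm 0 v)))
          refine lintegral_congr fun w => ?_
          simp [Fin.sum_univ_succ, add_assoc, MeasurableEquiv.piFinSuccAbove]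
      _ = ENNReal.ofReal (∏ k : Fin N, Real.cosh (c k.succ)) *
          ∫⁻ v, ENNReal.ofReal (exp (S + f 0 v)).trace ∂ν := by
          simp_rw [ENNReal.ofReal_mul hP]
          rw [lintegral_const_mul' _ _ ENNReal.ofReal_ne_top]
      _ ≤ ENNReal.ofReal (∏ k : Fin N, Real.cosh (c k.succ)) *
          ENNReal.ofReal (Real.cosh (c 0) * (exp S).trace) := by
          gcongr
          exact lintegral_trace_exp_add_le ν (hsymm 0) (hint 0) (hmean 0) (hc 0) hS
      _ = _ := by
          rw [← ENNReal.ofReal_mul hP, Fin.prod_univ_succ]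
          congr 1
          ring

/-- One-sided matrix Hoeffding inequality. -/
theorem measure_not_posSemidef_sub_sum_le (ν : Measure V) [IsProbabilityMeasure ν] {N : ℕ}
    {f : Fin N → V → Matrix n n ℝ} (hsymm : ∀ k v, (f k v).IsSymm) (hf : ∀ k, Measurable (f k))
    (hint : ∀ k i j, Integrable (fun v => f k v i j) ν)
    (hmean : ∀ k i j, ∫ v, f k v i j ∂ν = 0) {c : Fin N → ℝ}
    (hc : ∀ k, ∀ᵐ v ∂ν, (c k • 1 - f k v).PosSemidef ∧ (c k • 1 + f k v).PosSemidef)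
    {t : ℝ} (ht : 0 ≤ t) (hσ : 0 < ∑ k, c k ^ 2) :
    (Measure.pi fun _ : Fin N => ν) {v | ¬ (t • 1 - ∑ k, f k (v k)).PosSemidef} ≤
      ENNReal.ofReal (Fintype.card n * Real.exp (-(t ^ 2 / (2 * ∑ k, c k ^ 2)))) := by
  set σ := ∑ k, c k ^ 2 with hσdef
  -- This value minimizes the Chernoff exponent `θ² σ / 2 - θ t`.
  set θ := t / σ with hθ
  have hθ0 : 0 ≤ θ := by positivity
  have hscale : ∀ k, ∀ᵐ v ∂ν, ((θ * c k) • 1 - θ • f k v).PosSemidef ∧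
      ((θ * c k) • 1 + θ • f k v).PosSemidef := fun k => by
    filter_upwards [hc k] with v hv
    rw [mul_smul, ← smul_sub, ← smul_add]
    exact ⟨hv.1.smul hθ0, hv.2.smul hθ0⟩
  have hS0 : (0 : Matrix n n ℝ).IsSymm := Matrix.isSymm_zero
  have hmgf := lintegral_pi_trace_exp_add_le ν (f := fun k v => θ • f k v)
    (c := fun k => θ * c k) (fun k v => (hsymm k v).smul θ)
    (fun k => measurable_matrix_iff.2 fun i j => (measurable_matrix_iff.1 (hf k) i j).const_mul θ)
    (fun k i j => (hint k i j).const_mul θ)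
    (fun k i j => by simp [integral_const_mul, hmean]) hscale hS0
  have hmeas : Measurable fun v : Fin N → V =>
      ENNReal.ofReal (exp (0 + ∑ k, θ • f k (v k))).trace := by
    refine (measurable_trace_exp.comp ?_).ennreal_ofReal
    rw [measurable_matrix_iff]
    intro i j
    simp only [Matrix.add_apply, Matrix.sum_apply, Matrix.smul_apply]
    exact measurable_const.add (Finset.measurable_sum _ fun k _ =>
      ((measurable_matrix_iff.1 (hf k) i j).const_smul θ).comp (measurable_pi_apply k))
  have hsub : {v : Fin N → V | ¬ (t • 1 - ∑ k, f k (v k)).PosSemidef} ⊆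
      {v | ENNReal.ofReal (Real.exp (θ * t)) ≤
        ENNReal.ofReal (exp (0 + ∑ k, θ • f k (v k))).trace} := fun v hv => by
    refine ENNReal.ofReal_le_ofReal ?_
    rw [zero_add, ← Finset.smul_sum]
    refine exp_le_trace_exp_of_not_posSemidef ?_ hθ0 hv
    simp only [Matrix.IsSymm, Matrix.transpose_sum, (hsymm _ _).eq]
  refine (measure_mono hsub).trans ((meas_ge_le_lintegral_div hmeas.aemeasurable
    (by simp [Real.exp_pos]) ENNReal.ofReal_ne_top).trans ?_)
  refine (ENNReal.div_le_div_right hmgf _).trans ?_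
  rw [← ENNReal.ofReal_div_of_pos (Real.exp_pos _)]
  refine ENNReal.ofReal_le_ofReal ?_
  rw [div_le_iff₀ (Real.exp_pos _), mul_assoc, ← Real.exp_add, exp_zero, Matrix.trace_one, mul_comm]
  gcongr
  calc ∏ k, Real.cosh (θ * c k) ≤ ∏ k, Real.exp ((θ * c k) ^ 2 / 2) :=
        Finset.prod_le_prod (fun k _ => (Real.cosh_pos _).le) fun k _ =>
          Real.cosh_le_exp_half_sq _
    _ = Real.exp (θ ^ 2 * σ / 2) := by
        rw [← Real.exp_sum, hσdef, Finset.mul_sum, Finset.sum_div]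
        simp_rw [mul_pow]
    _ = _ := by
        congr 1
        rw [hθ]
        field_simp
        ring

/-- Two-sided matrix Hoeffding inequality, at confidence level `1 - δ`. -/
theorem measure_not_abs_sum_le_le (ν : Measure V) [IsProbabilityMeasure ν] {N : ℕ}
    {f : Fin N → V → Matrix n n ℝ} (hsymm : ∀ k v, (f k v).IsSymm) (hf : ∀ k, Measurable (f k))
    (hint : ∀ k i j, Integrable (fun v => f k v i j) ν)
    (hmean : ∀ k i j, ∫ v, f k v i j ∂ν = 0) {c : Fin N → ℝ}
    (hc : ∀ k, ∀ᵐ v ∂ν, (c k • 1 - f k v).PosSemidef ∧ (c k • 1 + f k v).PosSemidef)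
    {δ : ℝ} (hδ : 0 < δ) (hδ1 : δ < 1) {t : ℝ}
    (ht : t = √(∑ k, c k ^ 2) * √(2 * Real.log (2 * Fintype.card n / δ))) :
    (Measure.pi fun _ : Fin N => ν) {v | ¬ ((t • 1 - ∑ k, f k (v k)).PosSemidef ∧
      (t • 1 + ∑ k, f k (v k)).PosSemidef)} ≤ ENNReal.ofReal δ := by
  rcases isEmpty_or_nonempty n with hn | hn
  · have h : ∀ X : Matrix n n ℝ, X.PosSemidef := fun X => by
      rw [Subsingleton.elim X 0]; exact Matrix.PosSemidef.zero
    simp [h]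
  have hσ0 : 0 ≤ ∑ k, c k ^ 2 := Finset.sum_nonneg fun k _ => sq_nonneg _
  -- The one-sided bound divides by `∑ k, c k ^ 2`. If that vanishes, every `c k` is zero and the
  -- claim holds almost surely.
  rcases hσ0.eq_or_lt with hσ | hσ
  · have hck : ∀ k, c k = 0 := fun k => by
      have := (Finset.sum_eq_zero_iff_of_nonneg (fun k _ => sq_nonneg (c k))).1 hσ.symm k
        (Finset.mem_univ k)
      exact pow_eq_zero_iff two_ne_zero |>.1 this
    have ht0 : t = 0 := by rw [ht, ← hσ]; simp
    have hae : ∀ᵐ v ∂(Measure.pi fun _ : Fin N => ν), (t • 1 - ∑ k, f k (v k)).PosSemidef ∧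
        (t • 1 + ∑ k, f k (v k)).PosSemidef := by
      have : ∀ᵐ v ∂(Measure.pi fun _ : Fin N => ν), ∀ k,
          (c k • 1 - f k (v k)).PosSemidef ∧ (c k • 1 + f k (v k)).PosSemidef :=
        ae_all_iff.2 fun k => (measurePreserving_eval (fun _ : Fin N => ν) k).quasiMeasurePreserving.ae
          (hc k)
      filter_upwards [this] with v hv
      simp only [hck, zero_smul, zero_sub, zero_add, ht0] at hv ⊢
      rw [← Finset.sum_neg_distrib]
      exact ⟨Matrix.posSemidef_sum _ fun k _ => (hv k).1,
        Matrix.posSemidef_sum _ fun k _ => (hv k).2⟩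
    rw [ae_iff] at hae
    rw [hae]
    exact zero_le
  · have ht0 : 0 ≤ t := by rw [ht]; positivity
    have hcard : (1 : ℝ) ≤ Fintype.card n := by exact_mod_cast Fintype.card_pos
    have hlog : 0 ≤ Real.log (2 * Fintype.card n / δ) :=
      Real.log_nonneg ((one_le_div hδ).2 (by linarith))
    -- The radius is calibrated so that each of the two tails costs `δ / 2`.
    have hexp : Fintype.card n * Real.exp (-(t ^ 2 / (2 * ∑ k, c k ^ 2))) = δ / 2 := by
      have : t ^ 2 / (2 * ∑ k, c k ^ 2) = Real.log (2 * Fintype.card n / δ) := by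
        rw [ht, mul_pow, Real.sq_sqrt hσ0, Real.sq_sqrt (by positivity)]
        field_simp
      rw [this, Real.exp_neg, Real.exp_log (by positivity)]
      field_simp
    have h1 := measure_not_posSemidef_sub_sum_le ν hsymm hf hint hmean hc ht0 hσ
    have h2 := measure_not_posSemidef_sub_sum_le ν (f := fun k v => - f k v)
      (fun k v => (hsymm k v).neg)
      (fun k => measurable_matrix_iff.2 fun i j => (measurable_matrix_iff.1 (hf k) i j).neg)
      (fun k i j => (hint k i j).neg) (fun k i j => by simp [integral_neg, hmean])
      (fun k => (hc k).mono fun v hv => by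
        rw [sub_neg_eq_add, ← sub_eq_add_neg]; exact ⟨hv.2, hv.1⟩) ht0 hσ
    rw [hexp] at h1 h2
    have hsub : {v : Fin N → V | ¬ ((t • 1 - ∑ k, f k (v k)).PosSemidef ∧
        (t • 1 + ∑ k, f k (v k)).PosSemidef)} ⊆
        {v | ¬ (t • 1 - ∑ k, f k (v k)).PosSemidef} ∪
        {v | ¬ (t • 1 - ∑ k, - f k (v k)).PosSemidef} := fun v hv => by
      simp only [Set.mem_ofPred_eq, not_and_or, Set.mem_union, Finset.sum_neg_distrib,
        sub_neg_eq_add] at hv ⊢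
      exact hv
    refine (measure_mono hsub).trans ((measure_union_le _ _).trans ((add_le_add h1 h2).trans ?_))
    rw [← ENNReal.ofReal_add (by positivity) (by positivity), add_halves]

end Hoeffding

/-! ### Symmetrized vectorization -/

section Svec

variable {d : ℕ}

theorem symQ_mulVec {X : Matrix (Fin d) (Fin d) ℝ} (hX : X.IsSymm) :
    (symQ d *ᵥ fun q => X q.1 q.2) = svec X := by
  funext ⟨⟨i, j⟩, hij⟩
  simp only [Matrix.mulVec, dotProduct, symQ, Matrix.of_apply, svec]
  by_cases h : i = j
  · simp [h]
  · have h2 : √2 * √2 = (2 : ℝ) := Real.mul_self_sqrt (by norm_num)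
    have hs : ∀ q : Fin d × Fin d, (if q = (i, j) ∨ q = (i, j).swap then 1 / √2 else 0) * X q.1 q.2 =
        (if q = (i, j) then 1 / √2 * X q.1 q.2 else 0) +
          if q = (j, i) then 1 / √2 * X q.1 q.2 else 0 := fun q => by
      by_cases h1 : q = (i, j)
      · have : q ≠ (j, i) := fun h' => h (by rw [h1] at h'; exact (Prod.ext_iff.1 h').1)
        simp [h1, h]
      · by_cases h3 : q = (j, i) <;> simp [h1, h3, Ne.symm h]
    simp only [h, if_false, hs, Finset.sum_add_distrib, Finset.sum_ite_eq', Finset.mem_univ, if_true,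
      hX.apply i j]
    field_simp
    rw [pow_two, h2]
    ring

/-- Every position `(i, j)` meets exactly one lower-triangle index, with weight `1` on the diagonal
and `1 / √2` off it. Thus `Qᵀ` undoes `svec` on symmetric matrices, which lets `Q` cancel inside
symmetrized products; linearity of `unsvec` also comes from here. -/
theorem symQ_transpose_mulVec (y : SIdx d → ℝ) :
    ((symQ d)ᵀ *ᵥ y) = fun q => unsvec y q.1 q.2 := by
  funext ⟨i, j⟩
  simp only [Matrix.mulVec, dotProduct, symQ, Matrix.transpose_apply, Matrix.of_apply, unsvec]
  by_cases h : i = j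
  · subst h
    rw [Finset.sum_eq_single ⟨(i, i), le_rfl⟩]
    · simp
    · rintro ⟨⟨a, b⟩, hab⟩ - hne
      have h1 : ¬ (a = i ∧ b = i) := fun h' => hne (by simp [h'.1, h'.2])
      by_cases hab' : a = b
      · subst hab'
        have : ¬ i = a := fun h' => h1 ⟨h'.symm, h'.symm⟩
        simp [this]
      · have h2 : ¬ (i = a ∧ i = b) := fun h' => h1 ⟨h'.1.symm, h'.2.symm⟩
        have h3 : ¬ (i = b ∧ i = a) := fun h' => h1 ⟨h'.2.symm, h'.1.symm⟩
        simp [hab', h2, h3]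
    · simp
  · by_cases hji : j ≤ i
    · rw [Finset.sum_eq_single ⟨(i, j), hji⟩]
      · simp [h, hji, div_eq_inv_mul]
      · rintro ⟨⟨a, b⟩, hab⟩ - hne
        have h1 : ¬ (i = a ∧ j = b) := fun h' => hne (by simp [h'.1, h'.2])
        by_cases hab' : a = b
        · subst hab'
          simp [h1]
        · have h2 : ¬ (i = b ∧ j = a) := fun h' => h (le_antisymm (by
            rw [h'.1, h'.2]; exact hab) hji)
          simp [hab', h1, h2]
      · simp
    · have hij : i ≤ j := (lt_of_not_ge hji).le
      have h' : ¬ j = i := fun e => h e.symm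
      rw [Finset.sum_eq_single ⟨(j, i), hij⟩]
      · simp [h, h', hji, div_eq_inv_mul]
      · rintro ⟨⟨a, b⟩, hab⟩ - hne
        have h1 : ¬ (i = b ∧ j = a) := fun h' => hne (by simp [h'.1, h'.2])
        have h2 : ¬ (i = a ∧ j = b) := fun h' => hji (by rw [h'.1, h'.2]; exact hab)
        by_cases hab' : a = b
        · subst hab'
          simp [h2]
        · simp [hab', h1, h2]
      · simp

theorem unsvec_isSymm (y : SIdx d → ℝ) : (unsvec y).IsSymm := by
  ext i j
  simp only [Matrix.transpose_apply, unsvec, Matrix.of_apply]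
  rcases lt_trichotomy i j with h | h | h
  · simp [h.ne, h.ne', h.le, not_le.2 h]
  · simp [h]
  · simp [h.ne, h.ne', h.le, not_le.2 h]

theorem svec_unsvec (y : SIdx d → ℝ) : svec (unsvec y) = y := by
  funext ⟨⟨i, j⟩, hij⟩
  by_cases h : i = j
  · subst h; simp [svec, unsvec]
  · have : j ≤ i := hij
    simp only [svec, unsvec, Matrix.of_apply, h, if_false, this, dif_pos]
    field_simp

theorem unsvec_svec {X : Matrix (Fin d) (Fin d) ℝ} (hX : X.IsSymm) : unsvec (svec X) = X := by
  ext i j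
  simp only [unsvec, svec, Matrix.of_apply]
  rcases lt_trichotomy i j with h | h | h
  · simp [h.ne, h.ne', not_le.2 h, hX.apply i j]
  · simp [h]
  · simp [h.ne', h.le]

theorem svec_injOn {X Y : Matrix (Fin d) (Fin d) ℝ} (hX : X.IsSymm) (hY : Y.IsSymm)
    (h : svec X = svec Y) : X = Y := by
  rw [← unsvec_svec hX, h, unsvec_svec hY]

/-- `svec` as a linear map. -/
noncomputable def svecLin (d : ℕ) : Matrix (Fin d) (Fin d) ℝ →ₗ[ℝ] (SIdx d → ℝ) where
  toFun := svec
  map_add' X Y := by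
    funext p
    by_cases h : p.1.1 = p.1.2 <;> simp [svec, h, mul_add]
  map_smul' c X := by
    funext p
    by_cases h : p.1.1 = p.1.2 <;> simp [svec, h, mul_left_comm]

/-- `unsvec` as a linear map. -/
noncomputable def unsvecLin (d : ℕ) : (SIdx d → ℝ) →ₗ[ℝ] Matrix (Fin d) (Fin d) ℝ where
  toFun := unsvec
  map_add' x y := by
    ext i j
    have h := fun y : SIdx d → ℝ => (congrFun (symQ_transpose_mulVec y) (i, j)).symm
    simp only [Matrix.add_apply] at h ⊢
    rw [h, h, h, Matrix.mulVec_add, Pi.add_apply]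
  map_smul' c x := by
    ext i j
    have h := fun y : SIdx d → ℝ => (congrFun (symQ_transpose_mulVec y) (i, j)).symm
    simp only [Matrix.smul_apply, RingHom.id_apply] at h ⊢
    rw [h, h, Matrix.mulVec_smul, Pi.smul_apply]

/-- The operator with matrix `S` on symmetric matrices, as a linear map on all matrices. -/
noncomputable def symOpLin {m n : ℕ} (S : Matrix (SIdx m) (SIdx n) ℝ) :
    Matrix (Fin n) (Fin n) ℝ →ₗ[ℝ] Matrix (Fin m) (Fin m) ℝ :=
  unsvecLin m ∘ₗ Matrix.mulVecLin S ∘ₗ svecLin n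

theorem symOpLin_apply {m n : ℕ} (S : Matrix (SIdx m) (SIdx n) ℝ) (X : Matrix (Fin n) (Fin n) ℝ) :
    symOpLin S X = symOp S X := rfl

theorem isSymm_vecMulVec_self (z : Fin d → ℝ) : (Matrix.vecMulVec z z).IsSymm := by
  ext i j
  simp [Matrix.vecMulVec_apply, mul_comm]

theorem skronVec_eq_svec (z : Fin d → ℝ) : skronVec z = svec (Matrix.vecMulVec z z) := by
  rw [← symQ_mulVec (isSymm_vecMulVec_self z)]
  rfl

theorem symQ_transpose_mulVec_svec {X : Matrix (Fin d) (Fin d) ℝ} (hX : X.IsSymm) :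
    (symQ d)ᵀ *ᵥ svec X = fun q => X q.1 q.2 := by
  rw [symQ_transpose_mulVec, unsvec_svec hX]

theorem card_SIdx (d : ℕ) : Fintype.card (SIdx d) = d * (d + 1) / 2 := by
  have h : Fintype.card (SIdx d) = ∑ i : Fin d, ((i : ℕ) + 1) := by
    rw [Fintype.card_subtype, Finset.card_filter, Fintype.sum_prod_type]
    refine Finset.sum_congr rfl fun i _ => ?_
    rw [← Finset.card_filter]
    have : (Finset.univ.filter fun j : Fin d => j ≤ i) = Finset.Iic i := by ext j; simp
    simp only [this, Fin.card_Iic]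
  rw [h, Fin.sum_univ_eq_sum_range (fun i => i + 1) d]
  have h2 := Finset.sum_range_id_mul_two (d + 1)
  rw [Finset.sum_range_succ'] at h2
  simp only [add_zero, Nat.add_sub_cancel] at h2
  rw [mul_comm d]
  omega

end Svec

/-! ### Almost sure richness of the samples -/

section Generic

/-- On each line in direction `a` the form is a polynomial in the parameter with leading coefficient
`a ⬝ᵥ S *ᵥ a`, so it has finitely many zeros there. Null intersections with all parallel lines give
a null set. -/
theorem ae_quadratic_ne_zero {d : ℕ} (S : Matrix (Fin d) (Fin d) ℝ) {a : Fin d → ℝ}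
    (ha : a ⬝ᵥ S *ᵥ a ≠ 0) : ∀ᵐ z : Fin d → ℝ, z ⬝ᵥ S *ᵥ z ≠ 0 := by
  have hs : MeasurableSet {z : Fin d → ℝ | z ⬝ᵥ S *ᵥ z ≠ 0} := by
    refine (isOpen_ne_fun ?_ continuous_const).measurableSet
    fun_prop
  refine ae_mem_of_ae_add_linearMap_mem (LinearMap.toSpanSingleton ℝ (Fin d → ℝ) a) volume volume
    hs fun y => ?_
  open Polynomial in
  let p : ℝ[X] := C (a ⬝ᵥ S *ᵥ a) * X ^ 2 + C (y ⬝ᵥ S *ᵥ a + a ⬝ᵥ S *ᵥ y) * X + C (y ⬝ᵥ S *ᵥ y)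
  have hp : p ≠ 0 := fun h => ha <| by
    have := congrArg (fun q : Polynomial ℝ => q.coeff 2) h
    simpa [p, Polynomial.coeff_X, Polynomial.coeff_C] using this
  have hfin : {t : ℝ | p.eval t = 0}.Finite := Polynomial.finite_setOfPred_isRoot hp
  have hnull : ∀ᵐ t : ℝ, t ∉ {t : ℝ | p.eval t = 0} := hfin.countable.ae_notMem volume
  filter_upwards [hnull] with t ht
  intro h
  refine ht ?_
  rw [← h]
  simp [p, LinearMap.toSpanSingleton_apply, Matrix.mulVec_add, Matrix.mulVec_smul]
  ring

/-- Polarization: the values at `eᵢ`, `eⱼ` and `eᵢ + eⱼ` determine the entries. -/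
theorem exists_quadratic_ne_zero {d : ℕ} {S : Matrix (Fin d) (Fin d) ℝ} (hS : S.IsSymm)
    (h0 : S ≠ 0) : ∃ a, a ⬝ᵥ S *ᵥ a ≠ 0 := by
  by_contra! h
  refine h0 ?_
  ext i j
  have h1 := h (Pi.single i 1)
  have h2 := h (Pi.single j 1)
  have h3 := h (Pi.single i 1 + Pi.single j 1)
  simp only [Matrix.mulVec_add, dotProduct_add, add_dotProduct, h1, h2] at h3
  simp at h3
  have := hS.apply i j
  simp
  linarith

theorem ae_dotProduct_skronVec_ne_zero {d : ℕ} {s : SIdx d → ℝ} (hs : s ≠ 0) :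
    ∀ᵐ z : Fin d → ℝ, s ⬝ᵥ skronVec z ≠ 0 := by
  have h0 : unsvec s ≠ 0 := fun h => hs <| by
    rw [← svec_unsvec s, h]
    exact (svecLin d).map_zero
  obtain ⟨a, ha⟩ := exists_quadratic_ne_zero (unsvec_isSymm s) h0
  filter_upwards [ae_quadratic_ne_zero _ ha] with z hz
  convert! hz using 1
  rw [skronVec, Matrix.dotProduct_mulVec, ← Matrix.mulVec_transpose, symQ_transpose_mulVec]
  simp only [dotProduct, Fintype.sum_prod_type, Matrix.mulVec, Finset.mul_sum]
  exact Finset.sum_congr rfl fun i _ => Finset.sum_congr rfl fun j _ => by ring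

/-- Given the other rows, the determinant is a linear form in the functions at the first sample,
with the cofactors as coefficients. By induction one cofactor is almost surely nonzero, so the
hypothesis on linear combinations applies to the first sample. -/
theorem ae_det_ne_zero {E : Type*} [MeasurableSpace E] (κ : Measure E) [SigmaFinite κ] {d : ℕ}
    {φ : Fin d → E → ℝ} (hφ : ∀ j, Measurable (φ j))
    (h : ∀ s : Fin d → ℝ, s ≠ 0 → ∀ᵐ z ∂κ, ∑ j, s j * φ j z ≠ 0) :
    ∀ᵐ z ∂(Measure.pi fun _ : Fin d => κ), (Matrix.of fun i j => φ j (z i)).det ≠ 0 := by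
  induction d with
  | zero => simp
  | succ d ih =>
    have hmp := (measurePreserving_piFinSuccAbove (fun _ : Fin (d + 1) => κ) 0).symm
    have hmeas : MeasurableSet {z : Fin (d + 1) → E | (Matrix.of fun i j => φ j (z i)).det ≠ 0} := by
      refine (measurableSet_singleton (0 : ℝ)).compl.preimage ?_
      simp only [Matrix.det_apply]
      refine Finset.measurable_sum _ fun σ _ => Measurable.const_smul ?_ _
      exact Finset.measurable_prod _ fun i _ => (hφ _).comp (measurable_pi_apply _)
    rw [← hmp.map_eq, ae_map_iff hmp.measurable.aemeasurable hmeas]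
    set T := (MeasurableEquiv.piFinSuccAbove (fun _ : Fin (d + 1) => E) 0).symm ⁻¹'
      {z | (Matrix.of fun i j => φ j (z i)).det ≠ 0}
    have hmeas' : MeasurableSet T := hmp.measurable hmeas
    refine (Measure.ae_prod_iff_ae_ae (p := fun p => p ∈ T) hmeas').2 ?_
    -- The order of integration is swapped so that the remaining samples, which fix the cofactors,
    -- are drawn first.
    rw [Measure.ae_ae_comm (p := fun x y => (x, y) ∈ T) hmeas']
    have hih := ih (φ := fun j => φ j.succ) (fun j => hφ j.succ) fun s hs => by
      have := h (Fin.cons 0 s) fun h0 => hs <| by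
        funext j
        simpa using congrFun h0 j.succ
      simpa [Fin.sum_univ_succ] using this
    filter_upwards [hih] with w hw
    let m : Fin (d + 1) → ℝ := fun j =>
      (-1) ^ (j : ℕ) * (Matrix.of fun (i : Fin d) (k : Fin d) => φ (j.succAbove k) (w i)).det
    have hm : m ≠ 0 := fun h0 => hw <| by
      simpa [m] using congrFun h0 0
    filter_upwards [h m hm] with z hz
    refine fun h0 => hz ?_
    rw [← h0, Matrix.det_succ_row_zero]
    refine Finset.sum_congr rfl fun j _ => ?_
    simp only [m, MeasurableEquiv.piFinSuccAbove, Matrix.submatrix, Matrix.of_apply]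
    simp
    ring_nf

theorem ae_forall_dotProduct_skronVec_eq_zero {Ω : Type*} [MeasurableSpace Ω] {P : Measure Ω}
    [IsProbabilityMeasure P] {n N : ℕ} {κ : Measure (Fin n → ℝ)} (hκ : κ ≪ volume)
    {z : Fin N → Ω → Fin n → ℝ} (hz : ∀ i, HasLaw (z i) κ P) (hind : iIndepFun z P)
    (hN : n * (n + 1) / 2 ≤ N) :
    ∀ᵐ ω ∂P, ∀ s : SIdx n → ℝ, (∀ i, s ⬝ᵥ skronVec (z i ω) = 0) → s = 0 := by
  rcases isEmpty_or_nonempty (SIdx n) with he | he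
  -- With no coordinates `N` may be `0`, and then no sample is available to show that `κ` is a
  -- probability measure.
  · exact Filter.Eventually.of_forall fun ω s _ => Subsingleton.elim _ _
  have hN' : Fintype.card (SIdx n) ≤ N := by rwa [card_SIdx]
  have hpos : 0 < N := Fintype.card_pos.trans_le hN'
  have hκp : IsProbabilityMeasure κ := by
    rw [← (hz ⟨0, hpos⟩).map_eq]
    exact Measure.isProbabilityMeasure_map (hz ⟨0, hpos⟩).aemeasurable
  let e := Fintype.equivFin (SIdx n)
  let ι := Fin.castLE hN'
  have hlaw : P.map (fun ω i => z (ι i) ω) =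
      Measure.pi fun _ : Fin (Fintype.card (SIdx n)) => κ := by
    rw [(iIndepFun_iff_map_fun_eq_pi_map fun i => (hz (ι i)).aemeasurable).1
      (hind.precomp (Fin.castLE_injective hN'))]
    simp only [(hz _).map_eq]
  have hdet := ae_det_ne_zero κ (φ := fun j z => skronVec z (e.symm j)) (fun j => by
      refine Continuous.measurable ?_
      unfold skronVec
      fun_prop) fun s hs => by
    have hs' : (fun p => s (e p)) ≠ 0 := fun h0 => hs <| by
      funext j
      simpa using congrFun h0 (e.symm j)
    filter_upwards [hκ.ae_le (ae_dotProduct_skronVec_ne_zero hs')] with z hz'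
    convert! hz' using 1
    rw [dotProduct, ← e.symm.sum_comp]
    simp
  rw [← hlaw] at hdet
  have hdet' := ae_of_ae_map (aemeasurable_pi_lambda _ fun i => (hz (ι i)).aemeasurable) hdet
  filter_upwards [hdet'] with ω hω s hs
  have h0 := Matrix.eq_zero_of_mulVec_eq_zero hω (v := fun j => s (e.symm j)) <| by
    funext i
    rw [Pi.zero_apply, ← hs (ι i), dotProduct, ← e.symm.sum_comp]
    simp only [Matrix.mulVec, dotProduct, Matrix.of_apply]
    exact Finset.sum_congr rfl fun j _ => mul_comm _ _
  funext p
  simpa using congrFun h0 (e p)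

end Generic

/-! ### Contractions of symmetrized tensors -/

section Contractions

theorem mode2Vec_tucker {I J K I' J' K' : Type*} [Fintype I] [Fintype J] [Fintype K] [Fintype J']
    (T : Tensor I J K) (X₁ : Matrix I' I ℝ) (X₂ : Matrix J' J ℝ) (X₃ : Matrix K' K ℝ)
    (y : J' → ℝ) :
    mode2Vec (tucker T X₁ X₂ X₃) y = X₁ * mode2Vec T (X₂ᵀ *ᵥ y) * X₃ᵀ := by
  ext a c
  simp only [mode2Vec, tucker, Matrix.of_apply, Matrix.mul_apply, Matrix.mulVec, dotProduct,
    Matrix.transpose_apply, Finset.mul_sum, Finset.sum_mul]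
  rw [Finset.sum_comm]
  conv_rhs => rw [Finset.sum_comm]
  refine Finset.sum_congr rfl fun i _ => ?_
  rw [Finset.sum_comm]
  conv_rhs => rw [Finset.sum_comm]
  refine Finset.sum_congr rfl fun j _ => ?_
  rw [Finset.sum_comm]
  exact Finset.sum_congr rfl fun k _ => Finset.sum_congr rfl fun b _ => by ring

theorem mode2Vec_tensorKron {I J K : Type*} [Fintype J] (T : Tensor I J K) (x : J → ℝ) :
    mode2Vec (tensorKron T) (fun q => x q.1 * x q.2) = mode2Vec T x ⊗ₖ mode2Vec T x := by
  ext ⟨i, i'⟩ ⟨k, k'⟩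
  simp only [mode2Vec, tensorKron, Matrix.of_apply, Matrix.kroneckerMap_apply,
    Fintype.sum_prod_type, Finset.sum_mul_sum]
  exact Finset.sum_congr rfl fun j _ => Finset.sum_congr rfl fun j' _ => by ring

theorem isSymm_mul_mul_transpose {m n : Type*} [Fintype n] {S : Matrix n n ℝ} (hS : S.IsSymm)
    (A : Matrix m n ℝ) : (A * S * Aᵀ).IsSymm := by
  simp [Matrix.IsSymm, Matrix.transpose_mul, hS.eq, Matrix.mul_assoc]

theorem kronecker_self_mulVec {m n : Type*} [Fintype m] [Fintype n] {S : Matrix n n ℝ}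
    (hS : S.IsSymm) (A : Matrix m n ℝ) :
    ((A ⊗ₖ A) *ᵥ fun q => S q.1 q.2) = fun q => (A * S * Aᵀ) q.1 q.2 := by
  have h1 : (fun q : n × n => S q.1 q.2) = Matrix.vec S := by
    funext q
    exact hS.apply q.2 q.1
  rw [h1, Matrix.kronecker_mulVec_vec]
  funext q
  exact (isSymm_mul_mul_transpose hS A).apply q.1 q.2

variable {nx nz nw N : ℕ}

/-- `Qᵀ` turns `z ⊛ z` and `svec S` back into the full vectors of `z zᵀ` and `S`. What remains is
the Kronecker square of `M ×₂ z` acting on `vec S`, that is, a congruence. -/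
theorem mode2Vec_tensorSkron_mulVec_svec (M : Tensor (Fin nx) (Fin nz) (Fin nw)) (z : Fin nz → ℝ)
    {S : Matrix (Fin nw) (Fin nw) ℝ} (hS : S.IsSymm) :
    mode2Vec (tensorSkron M) (skronVec z) *ᵥ svec S =
      svec (mode2Vec M z * S * (mode2Vec M z)ᵀ) := by
  rw [tensorSkron, mode2Vec_tucker, skronVec_eq_svec,
    symQ_transpose_mulVec_svec (isSymm_vecMulVec_self z), ← Matrix.mulVec_mulVec,
    symQ_transpose_mulVec_svec hS, ← Matrix.mulVec_mulVec]
  simp only [Matrix.vecMulVec_apply]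
  rw [mode2Vec_tensorKron, kronecker_self_mulVec hS, symQ_mulVec (isSymm_mul_mul_transpose hS _)]

theorem mode2Vec_tensorSkron_mulVec_skronVec (M : Tensor (Fin nx) (Fin nz) (Fin nw))
    (z : Fin nz → ℝ) (w : Fin nw → ℝ) :
    mode2Vec (tensorSkron M) (skronVec z) *ᵥ skronVec w = skronVec (mode2Vec M z *ᵥ w) := by
  rw [skronVec_eq_svec w, mode2Vec_tensorSkron_mulVec_svec M z (isSymm_vecMulVec_self w),
    skronVec_eq_svec, Matrix.mul_vecMulVec, Matrix.vecMulVec_mul, Matrix.vecMul_transpose]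

theorem skron_vecMulVec_self (z : Fin nz → ℝ) :
    skron (Matrix.vecMulVec z z) (Matrix.vecMulVec z z) =
      Matrix.vecMulVec (skronVec z) (skronVec z) := by
  have h : Matrix.vecMulVec z z ⊗ₖ Matrix.vecMulVec z z =
      Matrix.vecMulVec (fun q : Fin nz × Fin nz => z q.1 * z q.2) fun q => z q.1 * z q.2 := by
    ext ⟨i, i'⟩ ⟨j, j'⟩
    simp only [Matrix.kroneckerMap_apply, Matrix.vecMulVec_apply]
    ring
  rw [skron, ← two_smul ℝ (Matrix.vecMulVec z z ⊗ₖ Matrix.vecMulVec z z), h, Matrix.mul_smul,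
    Matrix.smul_mul, smul_smul, Matrix.mul_vecMulVec, Matrix.vecMulVec_mul,
    Matrix.vecMul_transpose]
  norm_num
  rfl

theorem unfold3_mul_vecMulVec_kronecker_one {I J K : Type*} [Fintype I] [Fintype J] [DecidableEq I]
    (T : Tensor I J K) (y : J → ℝ) :
    unfold3 T * (Matrix.vecMulVec y y ⊗ₖ (1 : Matrix I I ℝ)) * (unfold3 T)ᵀ =
      (mode2Vec T y)ᵀ * mode2Vec T y := by
  ext k l
  have h : ∀ (j : J) (i : I),
      (unfold3 T * (Matrix.vecMulVec y y ⊗ₖ (1 : Matrix I I ℝ))) k (j, i) =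
        mode2Vec T y i k * y j := fun j i => by
    simp only [Matrix.mul_apply, Fintype.sum_prod_type, Matrix.kroneckerMap_apply,
      Matrix.vecMulVec_apply, Matrix.one_apply, mul_ite, mul_one, mul_zero, Finset.sum_ite_eq',
      Finset.mem_univ, if_true, mode2Vec, Matrix.of_apply, Finset.sum_mul, unfold3, Matrix.vec]
    exact Finset.sum_congr rfl fun j' _ => by ring
  rw [Matrix.mul_apply, Fintype.sum_prod_type, Matrix.mul_apply, Finset.sum_comm]
  refine Finset.sum_congr rfl fun i _ => ?_
  simp only [h, Matrix.transpose_apply]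
  conv_rhs => rw [mode2Vec, Matrix.of_apply, Matrix.of_apply, Finset.mul_sum]
  exact Finset.sum_congr rfl fun j _ => by
    simp only [unfold3, Matrix.vec, Matrix.of_apply, mode2Vec]
    ring

/-- Identifies the terms in the definition of `Hᵢ` with the per-sample contributions to the normal
matrix of the stacked regressor. -/
theorem gramOp_vecMulVec_self (M : Tensor (Fin nx) (Fin nz) (Fin nw)) (z : Fin nz → ℝ) :
    gramOp M (Matrix.vecMulVec z z) =
      (mode2Vec (tensorSkron M) (skronVec z))ᵀ * mode2Vec (tensorSkron M) (skronVec z) := by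
  rw [gramOp, skron_vecMulVec_self, unfold3_mul_vecMulVec_kronecker_one]

end Contractions

/-! ### The least-squares estimator -/

section LeastSquares

theorem isMoorePenrose_pinv {m n : Type*} [Fintype m] [Fintype n] (A : Matrix m n ℝ) :
    IsMoorePenrose A (pinv A) :=
  (exists_isMoorePenrose A).choose_spec

theorem mul_eq_zero_of_transpose_mul_mul_eq_zero {m n : Type*} [Fintype m] [Fintype n]
    {A : Matrix m n ℝ} {x : n → ℝ} (h : (Aᵀ * A) *ᵥ x = 0) : A *ᵥ x = 0 := by
  rw [← dotProduct_self_eq_zero, Matrix.dotProduct_mulVec, Matrix.vecMul_mulVec,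
    ← Matrix.dotProduct_mulVec, h, dotProduct_zero]

/-- The right-hand side satisfies the Penrose conditions, so uniqueness applies. This form, valid
without full rank, splits the stacked least-squares solution into a sum over samples. -/
theorem pinv_eq_pinv_transpose_mul_self_mul {m n : Type*} [Fintype m] [Fintype n] [DecidableEq n]
    (A : Matrix m n ℝ) : pinv A = pinv (Aᵀ * A) * Aᵀ := by
  have hS : (Aᵀ * A).IsHermitian := by
    simpa using Matrix.isHermitian_conjTranspose_mul_self A
  obtain ⟨G, h1, h2, h3, h4⟩ := exists_symm_pinv (Aᵀ * A) hS
  have hG : pinv (Aᵀ * A) = G := by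
    refine (isMoorePenrose_pinv _).unique ⟨h1, h2, ?_, ?_⟩
    · rw [Matrix.transpose_mul, h3, Matrix.transpose_mul, Matrix.transpose_transpose, h4]
    · rw [Matrix.transpose_mul, h3, Matrix.transpose_mul, Matrix.transpose_transpose, h4]
  have hA : A * G * (Aᵀ * A) = A := by
    refine Matrix.ext_of_mulVec_single fun i => ?_
    have h := mul_eq_zero_of_transpose_mul_mul_eq_zero (A := A)
      (x := (G * (Aᵀ * A) - 1) *ᵥ Pi.single i 1) <| by
        rw [Matrix.mulVec_mulVec, Matrix.mul_sub, ← Matrix.mul_assoc _ G, h1, Matrix.mul_one,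
          sub_self, Matrix.zero_mulVec]
    rw [Matrix.mulVec_mulVec, Matrix.mul_sub, Matrix.mul_one, ← Matrix.mul_assoc A G,
      Matrix.sub_mulVec] at h
    exact sub_eq_zero.1 h
  rw [hG]
  refine (isMoorePenrose_pinv _).unique ⟨?_, ?_, ?_, ?_⟩
  · simpa [Matrix.mul_assoc] using hA
  · calc G * Aᵀ * A * (G * Aᵀ) = (G * (Aᵀ * A) * G) * Aᵀ := by simp only [Matrix.mul_assoc]
      _ = _ := by rw [h2]
  · simp [Matrix.transpose_mul, h3, Matrix.mul_assoc]
  · rw [Matrix.mul_assoc G, Matrix.transpose_mul, h3, h4]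
    simp [Matrix.transpose_mul]

variable {nx nz nw N : ℕ}

theorem dataMatrix_transpose_mulVec (M : Tensor (Fin nx) (Fin nz) (Fin nw)) (z : Fin N → Fin nz → ℝ)
    (y : Fin N → SIdx nx → ℝ) :
    ((dataMatrix M z)ᵀ *ᵥ fun i => y i.1 i.2) =
      ∑ i, (mode2Vec (tensorSkron M) (skronVec (z i)))ᵀ *ᵥ y i := by
  funext c
  rw [Finset.sum_apply]
  simp only [Matrix.mulVec, dotProduct, Fintype.sum_prod_type]
  rfl

theorem dataMatrix_transpose_mul_self (M : Tensor (Fin nx) (Fin nz) (Fin nw))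
    (z : Fin N → Fin nz → ℝ) :
    (dataMatrix M z)ᵀ * dataMatrix M z = ∑ i, gramOp M (Matrix.vecMulVec (z i) (z i)) := by
  ext c d
  simp only [gramOp_vecMulVec_self, Matrix.sum_apply, Matrix.mul_apply, Fintype.sum_prod_type]
  rfl

theorem dataMatrix_mulVec_apply (M : Tensor (Fin nx) (Fin nz) (Fin nw)) (z : Fin N → Fin nz → ℝ)
    (s : SIdx nw → ℝ) (i : Fin N) :
    (fun a => (dataMatrix M z *ᵥ s) (i, a)) = mode2Vec (tensorSkron M) (skronVec (z i)) *ᵥ s :=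
  rfl

theorem lsEstimate_eq_sum_symOp (M : Tensor (Fin nx) (Fin nz) (Fin nw)) (z : Fin N → Fin nz → ℝ)
    (w : Fin N → Fin nw → ℝ) :
    lsEstimate M z (fun i => mode2Vec M (z i) *ᵥ w i) =
      ∑ i, symOp (hMatrix M z i) (Matrix.vecMulVec (w i) (w i)) := by
  have h1 : dataVector (fun i => mode2Vec M (z i) *ᵥ w i) =
      fun i => (mode2Vec (tensorSkron M) (skronVec (z i.1)) *ᵥ skronVec (w i.1)) i.2 := by
    funext i
    rw [mode2Vec_tensorSkron_mulVec_skronVec]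
    rfl
  have h2 : pinv (dataMatrix M z) *ᵥ dataVector (fun i => mode2Vec M (z i) *ᵥ w i) =
      ∑ i, hMatrix M z i *ᵥ svec (Matrix.vecMulVec (w i) (w i)) := by
    rw [pinv_eq_pinv_transpose_mul_self_mul, ← Matrix.mulVec_mulVec, h1,
      dataMatrix_transpose_mulVec M z
        (fun i => mode2Vec (tensorSkron M) (skronVec (z i)) *ᵥ skronVec (w i)),
      dataMatrix_transpose_mul_self, Matrix.mulVec_sum]
    refine Finset.sum_congr rfl fun i _ => ?_
    rw [hMatrix, gramOp_vecMulVec_self (z := z i), ← skronVec_eq_svec, Matrix.mulVec_mulVec,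
      Matrix.mulVec_mulVec, Matrix.mul_assoc]
  rw [lsEstimate, h2]
  exact map_sum (unsvecLin nw) _ _

/-- The `Hₖ` add up to `pinv G * G`, so `svec` of the residual lies in the kernel of `G`. As `G` is
the normal matrix of the regressor, the regressor kills it as well, block by block. -/
theorem mode2Vec_mul_residual_eq_zero (M : Tensor (Fin nx) (Fin nz) (Fin nw))
    (z : Fin N → Fin nz → ℝ) {W : Matrix (Fin nw) (Fin nw) ℝ} (hW : W.IsSymm) (i : Fin N) :
    mode2Vec M (z i) * (W - ∑ k, symOp (hMatrix M z k) W) * (mode2Vec M (z i))ᵀ = 0 := by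
  set G := ∑ j, gramOp M (Matrix.vecMulVec (z j) (z j)) with hG
  have h1 : ∑ k, symOp (hMatrix M z k) W = unsvec ((pinv G * G) *ᵥ svec W) := by
    have : (pinv G * G) *ᵥ svec W = ∑ k, hMatrix M z k *ᵥ svec W := by
      conv_lhs => rw [hG, Finset.mul_sum, Matrix.sum_mulVec]
      rfl
    rw [this]
    exact (map_sum (unsvecLin nw) _ _).symm
  have hR : (W - ∑ k, symOp (hMatrix M z k) W).IsSymm := by
    rw [h1]
    exact hW.sub (unsvec_isSymm _)
  have h2 : svec (W - ∑ k, symOp (hMatrix M z k) W) = svec W - (pinv G * G) *ᵥ svec W := by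
    rw [h1]
    refine ((svecLin nw).map_sub _ _).trans ?_
    exact congrArg _ (svec_unsvec _)
  have h3 : dataMatrix M z *ᵥ svec (W - ∑ k, symOp (hMatrix M z k) W) = 0 := by
    apply mul_eq_zero_of_transpose_mul_mul_eq_zero
    rw [dataMatrix_transpose_mul_self, ← hG, h2, Matrix.mulVec_sub, Matrix.mulVec_mulVec,
      ← Matrix.mul_assoc, (isMoorePenrose_pinv G).1, sub_self]
  have h4 := dataMatrix_mulVec_apply M z (svec (W - ∑ k, symOp (hMatrix M z k) W)) i
  rw [h3, mode2Vec_tensorSkron_mulVec_svec M _ hR] at h4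
  refine svec_injOn (isSymm_mul_mul_transpose hR _) Matrix.isSymm_zero ?_
  rw [← h4]
  exact ((svecLin nx).map_zero).symm

end LeastSquares

/-! ### The second moment dynamics -/

section MomentMap

variable {nx nz nw N : ℕ}

/-- The matrix of the linear functional `Z ↦ E(W; Z) a b`. -/
def momentCoeff (M : Tensor (Fin nx) (Fin nz) (Fin nw)) (W : Matrix (Fin nw) (Fin nw) ℝ)
    (a b : Fin nx) : Matrix (Fin nz) (Fin nz) ℝ :=
  Matrix.of (M a) * W * (Matrix.of (M b))ᵀ

theorem momentMap_apply (M : Tensor (Fin nx) (Fin nz) (Fin nw)) (W : Matrix (Fin nw) (Fin nw) ℝ)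
    (Z : Matrix (Fin nz) (Fin nz) ℝ) (a b : Fin nx) :
    momentMap M W Z a b = ∑ q : Fin nz × Fin nz, momentCoeff M W a b q.1 q.2 * Z q.1 q.2 := by
  simp only [momentMap, momentCoeff, Matrix.mul_apply, Fintype.sum_prod_type, Matrix.transpose_apply,
    Matrix.of_apply, unfold1, Matrix.vec, Matrix.kroneckerMap_apply, Finset.sum_mul]
  rw [Finset.sum_congr rfl fun k' _ => Finset.sum_congr rfl fun j' _ => Finset.sum_comm,
    Finset.sum_comm]
  conv_rhs => rw [Finset.sum_comm]
  refine Finset.sum_congr rfl fun j' _ => ?_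
  rw [Finset.sum_congr rfl fun k' _ => rfl, Finset.sum_comm]
  refine Finset.sum_congr rfl fun j _ => ?_
  exact Finset.sum_congr rfl fun k' _ => Finset.sum_congr rfl fun k _ => by ring

theorem momentCoeff_dotProduct (M : Tensor (Fin nx) (Fin nz) (Fin nw))
    (W : Matrix (Fin nw) (Fin nw) ℝ) (z : Fin nz → ℝ) (a b : Fin nx) :
    z ⬝ᵥ momentCoeff M W a b *ᵥ z = (mode2Vec M z * W * (mode2Vec M z)ᵀ) a b := by
  have h : ∀ a, (Matrix.of (M a))ᵀ *ᵥ z = fun k => mode2Vec M z a k := fun a => by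
    funext k
    simp [Matrix.mulVec, dotProduct, mode2Vec, mul_comm]
  rw [momentCoeff, ← Matrix.mulVec_mulVec, ← Matrix.mulVec_mulVec, Matrix.dotProduct_mulVec,
    ← Matrix.mulVec_transpose, h, h, Matrix.dotProduct_mulVec]
  rfl

/-- Each entry of `E(R; Z)` is a linear functional of `Z` that vanishes at every `zᵢ zᵢᵀ`; since
these span the symmetric matrices, it vanishes on all of them. -/
theorem momentMap_eq_of_residual_eq_zero (M : Tensor (Fin nx) (Fin nz) (Fin nw))
    {z : Fin N → Fin nz → ℝ} (hz : ∀ s : SIdx nz → ℝ, (∀ i, s ⬝ᵥ skronVec (z i) = 0) → s = 0)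
    {R : Matrix (Fin nw) (Fin nw) ℝ}
    (hR : ∀ i, mode2Vec M (z i) * R * (mode2Vec M (z i))ᵀ = 0)
    {Z : Matrix (Fin nz) (Fin nz) ℝ} (hZ : Z.IsSymm) : momentMap M R Z = 0 := by
  ext a b
  -- The coefficient matrix need not be symmetric. Applying `symQ` keeps only its symmetric part,
  -- the only one seen by a symmetric `X`.
  have h : ∀ {X : Matrix (Fin nz) (Fin nz) ℝ}, X.IsSymm →
      (symQ nz *ᵥ fun q => momentCoeff M R a b q.1 q.2) ⬝ᵥ svec X =
        ∑ q : Fin nz × Fin nz, momentCoeff M R a b q.1 q.2 * X q.1 q.2 := fun {X} hX => by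
    rw [dotProduct_comm, Matrix.dotProduct_mulVec, ← Matrix.mulVec_transpose,
      symQ_transpose_mulVec_svec hX, dotProduct_comm]
    rfl
  have h0 := hz (symQ nz *ᵥ fun q => momentCoeff M R a b q.1 q.2) fun i => by
    have h1 := momentCoeff_dotProduct M R (z i) a b
    rw [hR, Matrix.zero_apply] at h1
    rw [skronVec_eq_svec, h (isSymm_vecMulVec_self _), ← h1]
    simp only [Fintype.sum_prod_type, dotProduct, Matrix.mulVec, Finset.mul_sum,
      Matrix.vecMulVec_apply]
    exact Finset.sum_congr rfl fun j _ => Finset.sum_congr rfl fun j' _ => by ring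
  rw [momentMap_apply, ← h hZ, h0, zero_dotProduct, Matrix.zero_apply]

theorem momentMap_sub (M : Tensor (Fin nx) (Fin nz) (Fin nw)) (W₁ W₂ : Matrix (Fin nw) (Fin nw) ℝ)
    (Z : Matrix (Fin nz) (Fin nz) ℝ) :
    momentMap M (W₁ - W₂) Z = momentMap M W₁ Z - momentMap M W₂ Z := by
  have h := Matrix.add_kronecker (W₁ - W₂) W₂ Z
  rw [sub_add_cancel] at h
  rw [momentMap, momentMap, momentMap, h, Matrix.mul_add, Matrix.add_mul, add_sub_cancel_right]

theorem posSemidef_momentMap (M : Tensor (Fin nx) (Fin nz) (Fin nw)) {W : Matrix (Fin nw) (Fin nw) ℝ}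
    {Z : Matrix (Fin nz) (Fin nz) ℝ} (hW : W.PosSemidef) (hZ : Z.PosSemidef) :
    (momentMap M W Z).PosSemidef := by
  simpa [momentMap] using (hW.kronecker hZ).mul_mul_conjTranspose_same (unfold1 M)

end MomentMap

/-! ### Model equivalence -/

section ModelEquivalence

variable {nx nu nv nw : ℕ}

/-- Row spaces are nested and have equal dimension, hence coincide. -/
theorem exists_mul_eq_of_rank_fromRows {m₁ m₂ n : Type*} [Fintype m₁] [Fintype m₂] [Fintype n]
    {A : Matrix m₁ n ℝ} {B : Matrix m₂ n ℝ} (h : (Matrix.fromRows A B).rank = A.rank)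
    (y : m₂ → ℝ) : ∃ c, Aᵀ *ᵥ c = Bᵀ *ᵥ y := by
  have hle : LinearMap.range Aᵀ.mulVecLin ≤ LinearMap.range (Matrix.fromRows A B)ᵀ.mulVecLin := by
    rintro _ ⟨c, rfl⟩
    refine ⟨Sum.elim c 0, ?_⟩
    simp [Matrix.transpose_fromRows, Matrix.fromCols_mulVec, Matrix.mulVec_transpose]
  have heq := Submodule.eq_of_le_of_finrank_eq hle (by
    change Aᵀ.rank = (Matrix.fromRows A B)ᵀ.rank
    rw [Matrix.rank_transpose, Matrix.rank_transpose, h])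
  have hmem : Bᵀ *ᵥ y ∈ LinearMap.range Aᵀ.mulVecLin := by
    rw [heq]
    refine ⟨Sum.elim 0 y, ?_⟩
    simp [Matrix.transpose_fromRows, Matrix.fromCols_mulVec, Matrix.mulVec_transpose]
  obtain ⟨c, hc⟩ := hmem
  exact ⟨c, hc⟩

/-- By the rank condition `V₍₃₎ᵀ v` lies in the range of `M₍₃₎ᵀ`, on which `M₍₃₎ᵀ (M₍₃₎ᵀ)⁺` is the
identity. -/
theorem unfold3_transpose_mulVec_modelNoise {nz : ℕ} {M : Tensor (Fin nx) (Fin nz) (Fin nw)}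
    {V : Tensor (Fin nx) (Fin nz) (Fin nv)} (h : ModelEquivalence M V) (v : Fin nv → ℝ) :
    (unfold3 M)ᵀ *ᵥ modelNoise M V v = (unfold3 V)ᵀ *ᵥ v := by
  obtain ⟨c, hc⟩ := exists_mul_eq_of_rank_fromRows (h.2.trans h.1.symm) v
  rw [modelNoise, ← hc, Matrix.mulVec_mulVec, Matrix.mulVec_mulVec, (isMoorePenrose_pinv _).1]

theorem mode2Vec_mulVec_apply {I J K : Type*} [Fintype J] [Fintype K] (T : Tensor I J K)
    (z : J → ℝ) (w : K → ℝ) (i : I) :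
    (mode2Vec T z *ᵥ w) i = ∑ j, z j * ((unfold3 T)ᵀ *ᵥ w) (j, i) := by
  simp only [Matrix.mulVec, dotProduct, mode2Vec, Matrix.of_apply, Finset.sum_mul,
    Finset.mul_sum, unfold3, Matrix.transpose_apply, Matrix.vec]
  rw [Finset.sum_comm]
  exact Finset.sum_congr rfl fun j _ => Finset.sum_congr rfl fun k _ => by ring

theorem mode2Vec_trueTensor_mulVec (A : Fin nv → Matrix (Fin nx) (Fin nx) ℝ)
    (B : Fin nv → Matrix (Fin nx) (Fin nu) ℝ) (x : Fin nx → ℝ) (u : Fin nu → ℝ) (v : Fin nv → ℝ) :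
    mode2Vec (trueTensor A B) (Fin.append x u) *ᵥ v = modeSum A v *ᵥ x + modeSum B v *ᵥ u := by
  funext i
  simp only [Matrix.mulVec, dotProduct, mode2Vec, Matrix.of_apply, trueTensor, Fin.sum_univ_add,
    Fin.append_left, Fin.append_right, modeSum, Pi.add_apply, Matrix.sum_apply, Matrix.smul_apply,
    smul_eq_mul, add_mul, Finset.sum_mul, Finset.sum_add_distrib]
  congr 1 <;>
  · rw [Finset.sum_comm]
    exact Finset.sum_congr rfl fun j _ => Finset.sum_congr rfl fun k _ => by ring

theorem dynamics_eq_mode2Vec_mulVec (A : Fin nv → Matrix (Fin nx) (Fin nx) ℝ)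
    (B : Fin nv → Matrix (Fin nx) (Fin nu) ℝ) {M : Tensor (Fin nx) (Fin (nx + nu)) (Fin nw)}
    (hM : ModelEquivalence M (trueTensor A B)) (x : Fin nx → ℝ) (u : Fin nu → ℝ)
    (v : Fin nv → ℝ) :
    modeSum A v *ᵥ x + modeSum B v *ᵥ u =
      mode2Vec M (Fin.append x u) *ᵥ modelNoise M (trueTensor A B) v := by
  funext i
  rw [← mode2Vec_trueTensor_mulVec, mode2Vec_mulVec_apply, mode2Vec_mulVec_apply,
    unfold3_transpose_mulVec_modelNoise hM]

end ModelEquivalence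

/-! ### Spectral norms of symmetric matrices and of operators between them -/

section SpecNorm

variable {n : Type*} [Fintype n] [DecidableEq n]

theorem specNorm_conj_diagonal {U : Matrix n n ℝ} (hU : Uᵀ * U = 1) (d : n → ℝ) :
    specNorm (U * Matrix.diagonal d * Uᵀ) = ‖d‖ := by
  open scoped Matrix.Norms.L2Operator in
  have hmem : U ∈ unitary (Matrix n n ℝ) := by
    rw [Unitary.mem_iff]
    exact ⟨by simpa [Matrix.star_eq_conjTranspose] using hU,
      by simpa [Matrix.star_eq_conjTranspose] using mul_eq_one_comm.1 hU⟩
  have hmem' : Uᵀ ∈ unitary (Matrix n n ℝ) := by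
    simpa [Matrix.star_eq_conjTranspose] using Unitary.star_mem hmem
  rw [specNorm, CStarRing.norm_mul_mem_unitary _ hmem', CStarRing.norm_mem_unitary_mul _ hmem,
    Matrix.l2_opNorm_diagonal]

theorem specNorm_le_of_posSemidef {X : Matrix n n ℝ} (hX : X.IsSymm) {c : ℝ} (hc : 0 ≤ c)
    (h1 : (c • 1 - X).PosSemidef) (h2 : (c • 1 + X).PosSemidef) : specNorm X ≤ c := by
  obtain ⟨U, d, hU, hU', rfl⟩ := exists_orthogonal_diagonalization hX
  rw [specNorm_conj_diagonal hU, pi_norm_le_iff_of_nonneg hc]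
  exact fun i => abs_le_of_posSemidef hU h1 h2 i

theorem posSemidef_of_specNorm_le {X : Matrix n n ℝ} (hX : X.IsSymm) {c : ℝ}
    (h : specNorm X ≤ c) : (c • 1 - X).PosSemidef ∧ (c • 1 + X).PosSemidef := by
  obtain ⟨U, d, hU, hU', rfl⟩ := exists_orthogonal_diagonalization hX
  rw [specNorm_conj_diagonal hU] at h
  have hd : ∀ i, |d i| ≤ c := fun i => (norm_le_pi_norm d i).trans h
  have e1 := smul_one_add_smul_conj_diagonal hU' d c (-1)
  have e2 := smul_one_add_smul_conj_diagonal hU' d c 1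
  rw [neg_one_smul, ← sub_eq_add_neg] at e1
  rw [one_smul] at e2
  rw [e1, e2, posSemidef_conj_diagonal_iff hU, posSemidef_conj_diagonal_iff hU]
  exact ⟨fun i => by linarith [(abs_le.1 (hd i)).2], fun i => by linarith [(abs_le.1 (hd i)).1]⟩

theorem specNorm_smul (c : ℝ) (X : Matrix n n ℝ) : specNorm (c • X) = |c| * specNorm X := by
  open scoped Matrix.Norms.L2Operator in
  exact norm_smul c X

theorem specNorm_nonneg (X : Matrix n n ℝ) : 0 ≤ specNorm X := by
  open scoped Matrix.Norms.L2Operator in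
  exact norm_nonneg X

theorem specNorm_eq_zero {X : Matrix n n ℝ} : specNorm X = 0 ↔ X = 0 := by
  open scoped Matrix.Norms.L2Operator in
  exact norm_eq_zero

theorem continuous_specNorm : Continuous (specNorm : Matrix n n ℝ → ℝ) := by
  open scoped Matrix.Norms.L2Operator in
  exact continuous_norm

theorem exists_specNorm_le_mul {m : Type*} [Fintype m] [DecidableEq m]
    (L : Matrix n n ℝ →ₗ[ℝ] Matrix m m ℝ) : ∃ C, 0 ≤ C ∧ ∀ X, specNorm (L X) ≤ C * specNorm X := by
  open scoped Matrix.Norms.L2Operator in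
  exact ⟨‖LinearMap.toContinuousLinearMap L‖, ContinuousLinearMap.opNorm_nonneg _,
    (LinearMap.toContinuousLinearMap L).le_opNorm⟩

end SpecNorm

/-! ### The induced operator norm on symmetric matrices. -/

section SymOpNorm

variable {m n : ℕ}

theorem bddAbove_symOpNorm (S : Matrix (SIdx m) (SIdx n) ℝ) :
    BddAbove {t | ∃ X : Matrix (Fin n) (Fin n) ℝ,
      X.IsSymm ∧ specNorm X ≤ 1 ∧ t = specNorm (symOp S X)} := by
  obtain ⟨C, hC, h⟩ := exists_specNorm_le_mul (symOpLin S)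
  refine ⟨C, ?_⟩
  rintro _ ⟨X, -, hX, rfl⟩
  exact (h X).trans (mul_le_of_le_one_right hC hX)

theorem specNorm_symOp_le (S : Matrix (SIdx m) (SIdx n) ℝ) {X : Matrix (Fin n) (Fin n) ℝ}
    (hX : X.IsSymm) {c : ℝ} (hc : specNorm X ≤ c) : specNorm (symOp S X) ≤ c * symOpNorm S := by
  rcases ((specNorm_nonneg X).trans hc).eq_or_lt with h0 | h0
  · have : X = 0 := specNorm_eq_zero.1 (le_antisymm (h0 ▸ hc) (specNorm_nonneg X))
    rw [this, ← h0, zero_mul, ← symOpLin_apply, map_zero, specNorm_eq_zero.2 rfl]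
  · have h1 : specNorm (symOp S (c⁻¹ • X)) ≤ symOpNorm S := by
      refine le_csSup (bddAbove_symOpNorm S) ⟨c⁻¹ • X, hX.smul _, ?_, rfl⟩
      rw [specNorm_smul, abs_of_pos (inv_pos.2 h0), inv_mul_le_one₀ h0]
      exact hc
    rwa [← symOpLin_apply, map_smul, symOpLin_apply, specNorm_smul, abs_of_pos (inv_pos.2 h0),
      inv_mul_le_iff₀ h0] at h1

/-- A supremum of continuous functions of `S` has closed sublevel sets. -/
theorem measurable_symOpNorm :
    Measurable (symOpNorm : Matrix (SIdx m) (SIdx n) ℝ → ℝ) := by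
  refine measurable_of_Iic fun a => IsClosed.measurableSet ?_
  have h : symOpNorm ⁻¹' Set.Iic a = ⋂ (X : Matrix (Fin n) (Fin n) ℝ) (_ : X.IsSymm)
      (_ : specNorm X ≤ 1), {S : Matrix (SIdx m) (SIdx n) ℝ | specNorm (symOp S X) ≤ a} := by
    ext S
    have hne : {t | ∃ X : Matrix (Fin n) (Fin n) ℝ,
        X.IsSymm ∧ specNorm X ≤ 1 ∧ t = specNorm (symOp S X)}.Nonempty :=
      ⟨_, 0, Matrix.isSymm_zero, by rw [specNorm_eq_zero.2 rfl]; exact zero_le_one, rfl⟩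
    rw [Set.mem_preimage, Set.mem_Iic, symOpNorm, csSup_le_iff (bddAbove_symOpNorm S) hne]
    simp only [Set.mem_iInter, Set.mem_ofPred_eq]
    constructor
    · exact fun h X h1 h2 => h _ ⟨X, h1, h2, rfl⟩
    · rintro h _ ⟨X, h1, h2, rfl⟩
      exact h X h1 h2
  rw [h]
  refine isClosed_iInter fun X => isClosed_iInter fun _ => isClosed_iInter fun _ =>
    isClosed_le (continuous_specNorm.comp ?_) continuous_const
  exact (unsvecLin m).continuous_of_finiteDimensional.comp (by fun_prop)

end SymOpNorm

/-! ### Measurability of the estimator -/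

section Measurability

/-- A preimage is the injective projection of a Borel piece of the graph, hence Borel by the
Lusin-Souslin theorem. -/
theorem measurable_of_isClosed_graph {E F : Type*} [TopologicalSpace E] [PolishSpace E]
    [MeasurableSpace E] [BorelSpace E] [TopologicalSpace F] [PolishSpace F] [MeasurableSpace F]
    [BorelSpace F] {f : E → F} (hf : IsClosed {p : E × F | f p.1 = p.2}) : Measurable f := by
  intro s hs
  have h : f ⁻¹' s = Prod.fst '' ({p : E × F | f p.1 = p.2} ∩ Prod.snd ⁻¹' s) := by
    ext x
    constructor
    · exact fun hx => ⟨(x, f x), ⟨rfl, hx⟩, rfl⟩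
    · rintro ⟨⟨a, b⟩, ⟨hab, hb⟩, rfl⟩
      have hab' : f a = b := hab
      exact hab' ▸ hb
  rw [h]
  refine (hf.measurableSet.inter (measurable_snd hs)).image_of_continuousOn_injOn
    continuous_fst.continuousOn ?_
  rintro ⟨a, b⟩ ⟨hab, -⟩ ⟨a', b'⟩ ⟨hab', -⟩ h
  have h1 : f a = b := hab
  have h2 : f a' = b' := hab'
  have h3 : a = a' := h
  subst h3
  rw [← h1, ← h2]

/-- The pseudo-inverse is discontinuous where the rank jumps, but its graph is cut out by the
Penrose equations and is therefore closed. -/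
theorem measurable_pinv {m n : Type*} [Fintype m] [Fintype n] :
    Measurable (pinv : Matrix m n ℝ → Matrix n m ℝ) := by
  refine measurable_of_isClosed_graph ?_
  have h : {p : Matrix m n ℝ × Matrix n m ℝ | pinv p.1 = p.2} =
      {p | IsMoorePenrose p.1 p.2} := by
    ext p
    refine ⟨fun h => ?_, fun h => (isMoorePenrose_pinv p.1).unique h⟩
    have h1 := isMoorePenrose_pinv p.1
    rwa [show pinv p.1 = p.2 from h] at h1
  rw [h]
  simp only [IsMoorePenrose, Set.ofPred_and]
  refine IsClosed.inter (isClosed_eq ?_ ?_) (IsClosed.inter (isClosed_eq ?_ ?_)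
    (IsClosed.inter (isClosed_eq ?_ ?_) (isClosed_eq ?_ ?_))) <;> fun_prop

theorem measurable_matrix_mul {α l m n : Type*} [MeasurableSpace α] [Countable l] [Fintype m]
    [Countable n] {f : α → Matrix l m ℝ} {g : α → Matrix m n ℝ} (hf : Measurable f)
    (hg : Measurable g) : Measurable fun a => f a * g a :=
  (continuous_fst.matrix_mul continuous_snd).measurable.comp (hf.prodMk hg)

theorem measurable_matrix_mulVec {α m n : Type*} [MeasurableSpace α] [Countable m] [Fintype n]
    {f : α → Matrix m n ℝ} {g : α → n → ℝ} (hf : Measurable f) (hg : Measurable g) :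
    Measurable fun a => f a *ᵥ g a :=
  (continuous_fst.matrix_mulVec continuous_snd).measurable.comp (hf.prodMk hg)

theorem measurable_unsvec {d : ℕ} : Measurable (unsvec : (SIdx d → ℝ) → Matrix (Fin d) (Fin d) ℝ) :=
  (unsvecLin d).continuous_of_finiteDimensional.measurable

theorem continuous_skronVec {d : ℕ} : Continuous (skronVec : (Fin d → ℝ) → SIdx d → ℝ) := by
  unfold skronVec
  fun_prop

variable {nx nz nw N : ℕ} (M : Tensor (Fin nx) (Fin nz) (Fin nw))

theorem continuous_mode2Vec {I J K : Type*} [Fintype J] (T : Tensor I J K) :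
    Continuous fun x : J → ℝ => mode2Vec T x := by
  unfold mode2Vec
  refine continuous_matrix fun i k => ?_
  simp only [Matrix.of_apply]
  fun_prop

theorem continuous_gramOp_vecMulVec_self :
    Continuous fun z : Fin nz → ℝ => gramOp M (Matrix.vecMulVec z z) := by
  simp only [gramOp_vecMulVec_self]
  have h := (continuous_mode2Vec (tensorSkron M)).comp (continuous_skronVec (d := nz))
  exact h.matrix_transpose.matrix_mul h

theorem measurable_hMatrix (i : Fin N) : Measurable fun z : Fin N → Fin nz → ℝ => hMatrix M z i := by
  have h : ∀ j : Fin N, Continuous fun z : Fin N → Fin nz → ℝ =>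
      gramOp M (Matrix.vecMulVec (z j) (z j)) := fun j =>
    (continuous_gramOp_vecMulVec_self M).comp (continuous_apply j)
  exact measurable_matrix_mul
    (measurable_pinv.comp (continuous_finsetSum _ fun j _ => h j).measurable) (h i).measurable

theorem measurable_betaW (r δ : ℝ) : Measurable fun z : Fin N → Fin nz → ℝ => betaW M r δ z := by
  have h : Measurable fun z : Fin N → Fin nz → ℝ => zetaW M z :=
    (Finset.measurable_sum _ fun i _ =>
      (measurable_symOpNorm.comp (measurable_hMatrix M i)).pow_const 2).sqrt
  exact (h.const_mul _).mul_const _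

theorem measurable_sum_symOp_hMatrix (W : Matrix (Fin nw) (Fin nw) ℝ) :
    Measurable fun z : Fin N → Fin nz → ℝ => ∑ i, symOp (hMatrix M z i) W := by
  have h : ∀ i : Fin N, Measurable fun z : Fin N → Fin nz → ℝ => symOp (hMatrix M z i) W := fun i =>
    measurable_unsvec.comp (measurable_matrix_mulVec (measurable_hMatrix M i) measurable_const)
  rw [measurable_matrix_iff]
  intro a b
  simp only [Matrix.sum_apply]
  exact Finset.measurable_sum _ fun i _ => measurable_matrix_iff.1 (h i) a b

theorem measurable_lsEstimate : Measurable fun p : (Fin N → Fin nz → ℝ) × (Fin N → Fin nx → ℝ) =>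
    lsEstimate M p.1 p.2 := by
  have hD : Continuous fun z : Fin N → Fin nz → ℝ => dataMatrix M z := by
    refine continuous_matrix fun i k => ?_
    have h := (continuous_mode2Vec (tensorSkron M)).comp (continuous_skronVec (d := nz))
    exact (h.matrix_elem i.2 k).comp (continuous_apply i.1)
  have hY : Continuous fun x : Fin N → Fin nx → ℝ => dataVector x :=
    continuous_pi fun i => (continuous_apply i.2).comp
      (continuous_skronVec.comp (continuous_apply i.1))
  exact measurable_unsvec.comp (measurable_matrix_mulVec
    (measurable_pinv.comp (hD.measurable.comp measurable_fst)) (hY.measurable.comp measurable_snd))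

/-- The samples for which the estimate is within the error radius of the projection of `W` onto the
row space of the regressor matrix. -/
def confidenceSet (W : Matrix (Fin nw) (Fin nw) ℝ) (r δ : ℝ) :
    Set ((Fin N → Fin nz → ℝ) × (Fin N → Fin nx → ℝ)) :=
  {p | (betaW M r δ p.1 • (1 : Matrix (Fin nw) (Fin nw) ℝ) -
      (lsEstimate M p.1 p.2 - ∑ i, symOp (hMatrix M p.1 i) W)).PosSemidef ∧
    (betaW M r δ p.1 • (1 : Matrix (Fin nw) (Fin nw) ℝ) +
      (lsEstimate M p.1 p.2 - ∑ i, symOp (hMatrix M p.1 i) W)).PosSemidef}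

theorem measurableSet_confidenceSet (W : Matrix (Fin nw) (Fin nw) ℝ) (r δ : ℝ) :
    MeasurableSet (confidenceSet (N := N) M W r δ) := by
  have h1 := measurable_matrix_iff.1 (measurable_lsEstimate (N := N) M)
  have h2 := measurable_matrix_iff.1 (measurable_sum_symOp_hMatrix (N := N) M W)
  have h3 := measurable_betaW (N := N) M r δ
  refine (isClosed_posSemidef.measurableSet.preimage (measurable_matrix_iff.2 fun a b => ?_)).inter
    (isClosed_posSemidef.measurableSet.preimage (measurable_matrix_iff.2 fun a b => ?_))
  · exact ((h3.comp measurable_fst).mul_const _).sub ((h1 a b).sub ((h2 a b).comp measurable_fst))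
  · exact ((h3.comp measurable_fst).mul_const _).add ((h1 a b).sub ((h2 a b).comp measurable_fst))

end Measurability

/-! ### The centred second moment of the noise -/

section CentredMoment

variable {V : Type*} [MeasurableSpace V] {ν : Measure V} {n : ℕ}

theorem posSemidef_integral {A : V → Matrix (Fin n) (Fin n) ℝ}
    (hint : ∀ i j, Integrable (fun v => A v i j) ν) (h : ∀ᵐ v ∂ν, (A v).PosSemidef)
    (hsymm : ∀ v, (A v).IsSymm) :
    (Matrix.of fun i j => ∫ v, A v i j ∂ν).PosSemidef := by
  refine .of_dotProduct_mulVec_nonneg ?_ fun x => ?_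
  · ext i j
    simp only [Matrix.conjTranspose_apply, Matrix.of_apply, star_trivial]
    exact integral_congr_ae (.of_forall fun v => (hsymm v).apply i j)
  · have h1 : ∀ i j, Integrable (fun v => x i * (A v i j * x j)) ν := fun i j =>
      ((hint i j).mul_const _).const_mul _
    have h2 : ∀ i, Integrable (fun v => ∑ j, x i * (A v i j * x j)) ν := fun i =>
      integrable_finsetSum _ fun j _ => h1 i j
    have e : star x ⬝ᵥ ((Matrix.of fun i j => ∫ v, A v i j ∂ν) *ᵥ x) =
        ∫ v, star x ⬝ᵥ (A v *ᵥ x) ∂ν := by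
      simp only [dotProduct, Matrix.mulVec, Matrix.of_apply, star_trivial, Finset.mul_sum]
      rw [integral_finsetSum _ fun i _ => h2 i]
      refine Finset.sum_congr rfl fun i _ => ?_
      rw [integral_finsetSum _ fun j _ => h1 i j]
      exact Finset.sum_congr rfl fun j _ => by rw [integral_const_mul, integral_mul_const]
    rw [e]
    exact integral_nonneg_of_ae (h.mono fun v hv => hv.dotProduct_mulVec_nonneg x)

theorem posSemidef_vecMulVec_self (w : Fin n → ℝ) : (Matrix.vecMulVec w w).PosSemidef := by
  simpa using Matrix.posSemidef_vecMulVec_self_star w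

/-- Cauchy-Schwarz, applied to the quadratic form of `w wᵀ`. -/
theorem posSemidef_sq_smul_one_sub_vecMulVec {w : Fin n → ℝ} {r : ℝ}
    (hr : ‖WithLp.toLp 2 w‖ ≤ r) :
    (r ^ 2 • (1 : Matrix (Fin n) (Fin n) ℝ) - Matrix.vecMulVec w w).PosSemidef := by
  refine .of_dotProduct_mulVec_nonneg ?_ fun x => ?_
  · simp [Matrix.IsHermitian]
  · have h1 : (w ⬝ᵥ x) ^ 2 ≤ (w ⬝ᵥ w) * (x ⬝ᵥ x) := by
      simp only [dotProduct, ← pow_two]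
      exact Finset.sum_mul_sq_le_sq_mul_sq _ _ _
    have h2 : w ⬝ᵥ w ≤ r ^ 2 := by
      have := pow_le_pow_left₀ (norm_nonneg _) hr 2
      rw [EuclideanSpace.real_norm_sq_eq] at this
      simpa [dotProduct, pow_two] using this
    have h3 : 0 ≤ x ⬝ᵥ x := by simpa using dotProduct_star_self_nonneg x
    have h4 : star x ⬝ᵥ ((r ^ 2 • (1 : Matrix (Fin n) (Fin n) ℝ) - Matrix.vecMulVec w w) *ᵥ x) =
        r ^ 2 * (x ⬝ᵥ x) - (w ⬝ᵥ x) ^ 2 := by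
      simp [Matrix.sub_mulVec, Matrix.smul_mulVec, Matrix.vecMulVec_mulVec, dotProduct_sub,
        dotProduct_comm x w, pow_two]
    rw [h4]
    nlinarith [mul_le_mul_of_nonneg_right h2 h3]

theorem integral_linearMap_apply_eq_zero {p : ℕ} {X : V → Matrix (Fin n) (Fin n) ℝ}
    (hint : ∀ i j, Integrable (fun v => X v i j) ν) (hmean : ∀ i j, ∫ v, X v i j ∂ν = 0)
    (L : Matrix (Fin n) (Fin n) ℝ →ₗ[ℝ] Matrix (Fin p) (Fin p) ℝ) (a b : Fin p) :
    Integrable (fun v => L (X v) a b) ν ∧ ∫ v, L (X v) a b ∂ν = 0 := by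
  have h : ∀ v, L (X v) a b = ∑ i, ∑ j, X v i j * L (Matrix.single i j 1) a b := fun v => by
    conv_lhs => rw [Matrix.matrix_eq_sum_single (X v)]
    simp only [map_sum, Matrix.sum_apply]
    refine Finset.sum_congr rfl fun i _ => Finset.sum_congr rfl fun j _ => ?_
    rw [← mul_one (X v i j), ← smul_eq_mul, ← Matrix.smul_single, map_smul, Matrix.smul_apply,
      smul_eq_mul, smul_eq_mul, mul_one]
  have h1 : ∀ i j, Integrable (fun v => X v i j * L (Matrix.single i j 1) a b) ν := fun i j =>
    (hint i j).mul_const _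
  have h2 : ∀ i, Integrable (fun v => ∑ j, X v i j * L (Matrix.single i j 1) a b) ν := fun i =>
    integrable_finsetSum _ fun j _ => h1 i j
  simp only [h]
  refine ⟨integrable_finsetSum _ fun i _ => h2 i, ?_⟩
  rw [integral_finsetSum _ fun i _ => h2 i]
  refine Finset.sum_eq_zero fun i _ => ?_
  rw [integral_finsetSum _ fun j _ => h1 i j]
  exact Finset.sum_eq_zero fun j _ => by rw [integral_mul_const, hmean, zero_mul]

variable [IsProbabilityMeasure ν] {w : V → Fin n → ℝ} {r : ℝ}

theorem integrable_mul_of_norm_le (hw : Measurable w) (hr : ∀ᵐ v ∂ν, ‖WithLp.toLp 2 (w v)‖ ≤ r)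
    (i j : Fin n) : Integrable (fun v => w v i * w v j) ν := by
  have hm : ∀ i, Measurable fun v => w v i := fun i => (measurable_pi_apply i).comp hw
  refine Integrable.of_bound ((hm i).mul (hm j)).aestronglyMeasurable (r * r) ?_
  filter_upwards [hr] with v hv
  have h : ∀ i, ‖w v i‖ ≤ r := fun i =>
    (PiLp.norm_apply_le (WithLp.toLp 2 (w v)) i).trans hv
  rw [norm_mul]
  exact mul_le_mul (h i) (h j) (norm_nonneg _) ((norm_nonneg _).trans (h i))

/-- Both `w wᵀ` and its mean lie between `0` and `r² I`, so their difference lies between `-r² I`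
and `r² I`. The triangle inequality would only give `2 r²`. -/
theorem specNorm_vecMulVec_sub_integral_le (hw : Measurable w)
    (hr : ∀ᵐ v ∂ν, ‖WithLp.toLp 2 (w v)‖ ≤ r) :
    ∀ᵐ v ∂ν, specNorm (Matrix.vecMulVec (w v) (w v) -
      Matrix.of fun i j => ∫ v, w v i * w v j ∂ν) ≤ r ^ 2 := by
  set W : Matrix (Fin n) (Fin n) ℝ := Matrix.of fun i j => ∫ v, w v i * w v j ∂ν with hW
  have hint := integrable_mul_of_norm_le hw hr
  have hWpos : W.PosSemidef := posSemidef_integral (A := fun v => Matrix.vecMulVec (w v) (w v)) hint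
    (.of_forall fun v => posSemidef_vecMulVec_self _) fun v => isSymm_vecMulVec_self _
  have hWsymm : W.IsSymm := by simpa [Matrix.IsHermitian, Matrix.IsSymm] using hWpos.1
  have hWle : (r ^ 2 • (1 : Matrix (Fin n) (Fin n) ℝ) - W).PosSemidef := by
    have h := posSemidef_integral (ν := ν)
      (A := fun v => r ^ 2 • (1 : Matrix (Fin n) (Fin n) ℝ) - Matrix.vecMulVec (w v) (w v))
      (fun i j => (integrable_const _).sub (hint i j))
      (hr.mono fun v hv => posSemidef_sq_smul_one_sub_vecMulVec hv)
      fun v => (Matrix.isSymm_one.smul _).sub (isSymm_vecMulVec_self _)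
    convert! h using 1
    ext i j
    simp only [Matrix.sub_apply, Matrix.of_apply, Matrix.vecMulVec_apply, hW]
    rw [integral_sub (integrable_const _) (hint i j)]
    simp
  filter_upwards [hr] with v hv
  refine specNorm_le_of_posSemidef ((isSymm_vecMulVec_self _).sub hWsymm) (sq_nonneg r) ?_ ?_
  · have h := (posSemidef_sq_smul_one_sub_vecMulVec hv).add hWpos
    convert! h using 1
    abel
  · have h := (posSemidef_vecMulVec_self (w v)).add hWle
    convert! h using 1
    abel

end CentredMoment

/-! ### The confidence bound -/

section Confidence

variable {V : Type*} [MeasurableSpace V] {nx nz nw N : ℕ}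

/-- With `z` deterministic the operators `Hₖ` are constant, so the error is a sum of independent
centred terms and Hoeffding applies with `c k = r² ‖Hₖ‖`, whose Euclidean norm is `r² ζ_W`. -/
theorem measure_pi_notMem_confidenceSet_le (ν : Measure V) [IsProbabilityMeasure ν]
    (M : Tensor (Fin nx) (Fin nz) (Fin nw)) {w : V → Fin nw → ℝ} (hw : Measurable w) {r : ℝ}
    (hr : ∀ᵐ v ∂ν, ‖WithLp.toLp 2 (w v)‖ ≤ r) {δ : ℝ} (hδ : 0 < δ) (hδ1 : δ < 1)
    (z : Fin N → Fin nz → ℝ) :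
    (Measure.pi fun _ : Fin N => ν) {v | (z, fun i => mode2Vec M (z i) *ᵥ w (v i)) ∉
      confidenceSet M (Matrix.of fun i j => ∫ v, w v i * w v j ∂ν) r δ} ≤ ENNReal.ofReal δ := by
  set W : Matrix (Fin nw) (Fin nw) ℝ := Matrix.of fun i j => ∫ v, w v i * w v j ∂ν with hW
  have hWsymm : W.IsSymm := by
    ext i j
    simp [hW, mul_comm]
  let X : V → Matrix (Fin nw) (Fin nw) ℝ := fun v => Matrix.vecMulVec (w v) (w v) - W
  have hXsymm : ∀ v, (X v).IsSymm := fun v => (isSymm_vecMulVec_self _).sub hWsymm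
  have hXint : ∀ i j, Integrable (fun v => X v i j) ν := fun i j =>
    (integrable_mul_of_norm_le hw hr i j).sub (integrable_const _)
  have hXmean : ∀ i j, ∫ v, X v i j ∂ν = 0 := fun i j => by
    have h := integral_sub (integrable_mul_of_norm_le hw hr i j) (integrable_const (W i j))
    refine h.trans ?_
    simp [hW]
  have hXmeas : Measurable X := measurable_matrix_iff.2 fun i j =>
    (((measurable_pi_apply i).comp hw).mul ((measurable_pi_apply j).comp hw)).sub_const _
  have hXle : ∀ᵐ v ∂ν, specNorm (X v) ≤ r ^ 2 := specNorm_vecMulVec_sub_integral_le hw hr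
  let f : Fin N → V → Matrix (Fin nw) (Fin nw) ℝ := fun k v => symOpLin (hMatrix M z k) (X v)
  have hf := measure_not_abs_sum_le_le ν (f := f) (c := fun k => r ^ 2 * symOpNorm (hMatrix M z k))
    (fun k v => unsvec_isSymm _)
    (fun k => (symOpLin (hMatrix M z k)).continuous_of_finiteDimensional.measurable.comp hXmeas)
    (fun k i j => (integral_linearMap_apply_eq_zero hXint hXmean _ i j).1)
    (fun k i j => (integral_linearMap_apply_eq_zero hXint hXmean _ i j).2)
    (fun k => hXle.mono fun v hv => posSemidef_of_specNorm_le (unsvec_isSymm _)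
      (specNorm_symOp_le _ (hXsymm v) hv)) hδ hδ1 (t := betaW M r δ z) (by
        simp only [mul_pow, ← Finset.mul_sum]
        rw [Real.sqrt_mul (by positivity), Real.sqrt_sq (by positivity), Fintype.card_fin]
        rfl)
  refine le_trans (le_of_eq ?_) hf
  congr 1
  ext v
  have hsum : lsEstimate M z (fun i => mode2Vec M (z i) *ᵥ w (v i)) -
      ∑ i, symOp (hMatrix M z i) W = ∑ k, f k (v k) := by
    rw [lsEstimate_eq_sum_symOp, ← Finset.sum_sub_distrib]
    refine Finset.sum_congr rfl fun k _ => ?_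
    exact ((symOpLin (hMatrix M z k)).map_sub _ _).symm
  simp only [confidenceSet, Set.mem_ofPred_eq, hsum]

/-- For rich samples `W` and its projection have the same image under `E(·; Z)`. The Loewner bounds
on the projection then transfer by monotonicity. -/
theorem momentMap_bounds_of_mem_confidenceSet (M : Tensor (Fin nx) (Fin nz) (Fin nw))
    {z : Fin N → Fin nz → ℝ} {x : Fin N → Fin nx → ℝ} {W : Matrix (Fin nw) (Fin nw) ℝ}
    (hW : W.IsSymm) {r δ : ℝ} (h : (z, x) ∈ confidenceSet M W r δ)
    (hz : ∀ s : SIdx nz → ℝ, (∀ i, s ⬝ᵥ skronVec (z i) = 0) → s = 0)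
    {Z : Matrix (Fin nz) (Fin nz) ℝ} (hZ : Z.PosSemidef) :
    (momentMap M W Z - momentMap M (lsEstimate M z x -
      betaW M r δ z • (1 : Matrix (Fin nw) (Fin nw) ℝ)) Z).PosSemidef ∧
    (momentMap M (lsEstimate M z x + betaW M r δ z • (1 : Matrix (Fin nw) (Fin nw) ℝ)) Z -
      momentMap M W Z).PosSemidef := by
  have hZs : Z.IsSymm := by simpa [Matrix.IsHermitian, Matrix.IsSymm] using hZ.1
  have h0 := momentMap_eq_of_residual_eq_zero M hz (mode2Vec_mul_residual_eq_zero M z hW) hZs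
  rw [momentMap_sub, sub_eq_zero] at h0
  rw [h0, ← momentMap_sub, ← momentMap_sub]
  refine ⟨posSemidef_momentMap M ?_ hZ, posSemidef_momentMap M ?_ hZ⟩
  · convert! h.1 using 1
    abel
  · convert! h.2 using 1
    abel

theorem measurable_modelNoise {nv : ℕ} (M : Tensor (Fin nx) (Fin nz) (Fin nw))
    (V : Tensor (Fin nx) (Fin nz) (Fin nv)) : Measurable (modelNoise M V) := by
  refine Continuous.measurable ?_
  unfold modelNoise
  fun_prop

end Confidence

/-! ### The law of the samples -/

section SampleLaw

variable {Ω E V X : Type*} [MeasurableSpace Ω] [MeasurableSpace E] [MeasurableSpace V]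
  [MeasurableSpace X] {P : Measure Ω} [IsProbabilityMeasure P] {N : ℕ}

/-- If the pairs `(xᵢ, zᵢ)` are independent, with `xᵢ = g(zᵢ, vᵢ)` almost surely for independent
`zᵢ` and `vᵢ`, then a set with conditional probability at most `ε` given the `zᵢ` has probability
at most `ε`. -/
theorem measure_samples_le {κ : Measure E} [IsProbabilityMeasure κ] {ν : Measure V}
    [IsProbabilityMeasure ν] {z : Fin N → Ω → E} {v : Fin N → Ω → V} {x : Fin N → Ω → X}
    {g : E → V → X} (hg : Measurable g.uncurry) (hz : ∀ i, HasLaw (z i) κ P)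
    (hv : ∀ i, HasLaw (v i) ν P) (hzv : ∀ i, IndepFun (z i) (v i) P)
    (hx : ∀ i, ∀ᵐ ω ∂P, x i ω = g (z i ω) (v i ω))
    (hind : iIndepFun (fun i ω => (x i ω, z i ω)) P) {s : Set ((Fin N → E) × (Fin N → X))}
    (hs : MeasurableSet s) {ε : ENNReal}
    (h : ∀ z : Fin N → E, (Measure.pi fun _ : Fin N => ν) {v | (z, fun i => g (z i) (v i)) ∈ s} ≤ ε) :
    P {ω | (fun i => z i ω, fun i => x i ω) ∈ s} ≤ ε := by
  let F : E × V → X × E := fun p => (g p.1 p.2, p.1)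
  have hF : Measurable F := hg.prodMk measurable_fst
  have hae : ∀ i, (fun ω => (x i ω, z i ω)) =ᵐ[P] fun ω => F (z i ω, v i ω) := fun i => by
    filter_upwards [hx i] with ω hω
    simp [F, hω]
  have hzvm : ∀ i, AEMeasurable (fun ω => (z i ω, v i ω)) P := fun i =>
    (hz i).aemeasurable.prodMk (hv i).aemeasurable
  have hmeas : ∀ i, AEMeasurable (fun ω => (x i ω, z i ω)) P := fun i =>
    (hF.comp_aemeasurable (hzvm i)).congr (hae i).symm
  have hlaw1 : ∀ i, P.map (fun ω => (x i ω, z i ω)) = (κ.prod ν).map F := fun i => by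
    rw [Measure.map_congr (hae i), ← (hz i).map_eq, ← (hv i).map_eq,
      ← (indepFun_iff_map_prod_eq_prod_map_map (hz i).aemeasurable (hv i).aemeasurable).1 (hzv i),
      AEMeasurable.map_map_of_aemeasurable hF.aemeasurable (hzvm i)]
    rfl
  have hprob : IsProbabilityMeasure ((κ.prod ν).map F) :=
    Measure.isProbabilityMeasure_map hF.aemeasurable
  -- Only the pairs are assumed independent across samples, but this fixes their joint law: the
  -- samples may be replaced by a model with independent `z` and `v` vectors, where Fubini
  -- conditions on `z`.
  have hlaw : P.map (fun ω i => (x i ω, z i ω)) =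
      (Measure.pi fun _ : Fin N => κ.prod ν).map fun q i => F (q i) := by
    rw [(iIndepFun_iff_map_fun_eq_pi_map hmeas).1 hind,
      Measure.pi_map_pi fun _ => hF.aemeasurable]
    simp only [hlaw1]
  have hmp := (measurePreserving_arrowProdEquivProdArrow E V (Fin N) (fun _ => κ) fun _ => ν).symm
  let t : Set (Fin N → X × E) := {q | (fun i => (q i).2, fun i => (q i).1) ∈ s}
  have ht : MeasurableSet t := by
    refine hs.preimage (Measurable.prodMk ?_ ?_) <;> fun_prop
  have hFpi : Measurable fun (q : Fin N → E × V) i => F (q i) := by fun_prop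
  calc P {ω | (fun i => z i ω, fun i => x i ω) ∈ s}
      = P.map (fun ω i => (x i ω, z i ω)) t := by
        rw [Measure.map_apply_of_aemeasurable (aemeasurable_pi_lambda _ hmeas) ht]
        rfl
    _ = (Measure.pi fun _ : Fin N => κ.prod ν) ((fun q i => F (q i)) ⁻¹' t) := by
        rw [hlaw, Measure.map_apply hFpi ht]
    _ = ((Measure.pi fun _ : Fin N => κ).prod (Measure.pi fun _ : Fin N => ν))
          {p | (p.1, fun i => g (p.1 i) (p.2 i)) ∈ s} := by
        rw [← hmp.measure_preimage (hFpi ht).nullMeasurableSet]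
        rfl
    _ ≤ ∫⁻ _ : Fin N → E, ε ∂(Measure.pi fun _ : Fin N => κ) := by
        rw [Measure.prod_apply]
        · exact lintegral_mono fun z => h z
        · refine hs.preimage (measurable_fst.prodMk (measurable_pi_lambda _ fun i => ?_))
          have hi : Measurable fun p : (Fin N → E) × (Fin N → V) => (p.1 i, p.2 i) := by fun_prop
          exact hg.comp hi
    _ = ε := by simp

end SampleLaw

end MultNoise

open MultNoise
theorem mainTheorem1 {Ω : Type*} [MeasurableSpace Ω] (P : Measure Ω) [IsProbabilityMeasure P]
    {nx nu nv nw N : ℕ}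
    (A : Fin nv → Matrix (Fin nx) (Fin nx) ℝ) (B : Fin nv → Matrix (Fin nx) (Fin nu) ℝ)
    (M : Tensor (Fin nx) (Fin (nx + nu)) (Fin nw))
    (hM : ModelEquivalence M (trueTensor A B))
    (κ : Measure (Fin (nx + nu) → ℝ)) (hκ : κ ≪ volume)
    (ν : Measure (Fin nv → ℝ)) [IsProbabilityMeasure ν]
    (r : ℝ) (hr : ∀ᵐ v ∂ν, ‖WithLp.toLp 2 (modelNoise M (trueTensor A B) v)‖ ≤ r)
    (x : Fin N → Ω → Fin nx → ℝ) (u : Fin N → Ω → Fin nu → ℝ) (v : Fin N → Ω → Fin nv → ℝ)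
    (xplus : Fin N → Ω → Fin nx → ℝ) (z : Fin N → Ω → Fin (nx + nu) → ℝ)
    (hz : ∀ i ω, z i ω = Fin.append (x i ω) (u i ω))
    (hzlaw : ∀ i, HasLaw (z i) κ P) (hvlaw : ∀ i, HasLaw (v i) ν P)
    (hzv : ∀ i, IndepFun (z i) (v i) P)
    (hdyn : ∀ i, ∀ᵐ ω ∂P,
      xplus i ω = modeSum A (v i ω) *ᵥ x i ω + modeSum B (v i ω) *ᵥ u i ω)
    (hindep : iIndepFun (fun i ω => (xplus i ω, z i ω)) P)
    (hN : (nx + nu) * (nx + nu + 1) / 2 ≤ N)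
    (δ : ℝ) (hδ : 0 < δ) (hδ1 : δ < 1) :
    ENNReal.ofReal (1 - δ) ≤ P {ω | ∀ Z : Matrix (Fin (nx + nu)) (Fin (nx + nu)) ℝ,
      Z.PosSemidef →
        (momentMap M (trueMoment M (trueTensor A B) ν) Z -
          momentMap M (lsEstimate M (fun i => z i ω) (fun i => xplus i ω) -
            betaW M r δ (fun i => z i ω) • (1 : Matrix (Fin nw) (Fin nw) ℝ)) Z).PosSemidef ∧
        (momentMap M (lsEstimate M (fun i => z i ω) (fun i => xplus i ω) +
            betaW M r δ (fun i => z i ω) • (1 : Matrix (Fin nw) (Fin nw) ℝ)) Z -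
          momentMap M (trueMoment M (trueTensor A B) ν) Z).PosSemidef} := by
  -- If the dimension is zero, every state matrix is empty and nothing is to be shown; otherwise at
  -- least one sample exists.
  rcases Nat.eq_zero_or_pos (nx + nu) with h0 | h0
  · have : IsEmpty (Fin nx) := by
      rw [(Nat.add_eq_zero_iff.1 h0).1]
      infer_instance
    have h : ∀ X : Matrix (Fin nx) (Fin nx) ℝ, X.PosSemidef := fun X => by
      rw [Subsingleton.elim X 0]
      exact Matrix.PosSemidef.zero
    simp [h, hδ.le]
  have hNpos : 0 < N := by
    refine lt_of_lt_of_le (Nat.div_pos ?_ two_pos) hN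
    nlinarith
  have hκp : IsProbabilityMeasure κ := by
    rw [← (hzlaw ⟨0, hNpos⟩).map_eq]
    exact Measure.isProbabilityMeasure_map (hzlaw ⟨0, hNpos⟩).aemeasurable
  set W := trueMoment M (trueTensor A B) ν with hW
  have hWsymm : W.IsSymm := by
    ext i j
    simp [hW, trueMoment, mul_comm]
  have hw := measurable_modelNoise M (trueTensor A B)
  have hbad : P {ω | (fun i => z i ω, fun i => xplus i ω) ∈ (confidenceSet M W r δ)ᶜ} ≤
      ENNReal.ofReal δ := by
    refine measure_samples_le (g := fun z v => mode2Vec M z *ᵥ modelNoise M (trueTensor A B) v)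
      (measurable_matrix_mulVec ((continuous_mode2Vec M).measurable.comp measurable_fst)
        (hw.comp measurable_snd)) hzlaw hvlaw hzv (fun i => ?_) hindep
      (measurableSet_confidenceSet M W r δ).compl fun z =>
        measure_pi_notMem_confidenceSet_le ν M hw hr hδ hδ1 z
    filter_upwards [hdyn i] with ω hω
    rw [hω, hz, dynamics_eq_mode2Vec_mulVec A B hM]
  have hrich := ae_forall_dotProduct_skronVec_eq_zero hκ hzlaw
    (hindep.comp (fun _ => Prod.snd) fun _ => measurable_snd) hN
  set S := {ω | ∀ Z : Matrix (Fin (nx + nu)) (Fin (nx + nu)) ℝ, Z.PosSemidef → _} with hS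
  -- `S` quantifies over uncountably many `Z` and is not shown to be measurable, so its complement
  -- is covered, up to a null set, by a measurable bad event, and subadditivity of the outer measure
  -- finishes the proof.
  have hcompl : P Sᶜ ≤ ENNReal.ofReal δ := by
    refine (measure_mono_ae ?_).trans hbad
    filter_upwards [hrich] with ω hω hωS hmem
    exact hωS fun Z hZ => momentMap_bounds_of_mem_confidenceSet M hWsymm hmem hω hZ
  rw [ENNReal.ofReal_sub _ hδ.le, ENNReal.ofReal_one, tsub_le_iff_right]
  calc (1 : ENNReal) = P Set.univ := measure_univ.symm
    _ ≤ P S + P Sᶜ := by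
        rw [← Set.union_compl_self S]
        exact measure_union_le _ _
    _ ≤ P S + ENNReal.ofReal δ := by gcongr
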